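/- All graphs are finite, simple, undirected and have at least one vertex. For positive integers $k$ and $t$, a $(k,t)$-list assignment to a graph $G$ is a map $L$ that assigns to each vertex $v$ a set $L(v)$ of exactly $k$ colors such that $\left|\bigcup_{v\in V(G)} L(v)\right| = t$. An $L$-coloring is a proper vertex coloring $c$ of $G$ with $c(v)\in L(v)$ for every vertex $v$. The graph $G$ is uniquely $(k,t)$-list colorable if there is a $(k,t)$-list assignment $L$ to $G$ for which $G$ has exactly one $L$-coloring, and it is uniquely $k$-list colorable if it is uniquely $(k,t)$-list colorable for some $t$. Let $\chi_u(G,k)$ be the least $t$ such that $G$ is uniquely $(k,t)$-list colorable, and $0$ if there is no such $t$. Let $\chi(G)$ be the chromatic number of $G$. **Theorem.** Let $G$ be a graph and $t=\max\{3,\chi(G)\}$. Then $G$ is uniquely $2$-list colorable if and only if $G$ is uniquely $(2,t)$-list colorable. Moreover, if $G$ is uniquely $2$-list colorable, then $\chi_u(G,2)=\max\{3,\chi(G)\}$. -/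

import Mathlib

namespace UniqueListColoring

variable {V : Type*} [Fintype V]

/-- An `(f,t)`-list assignment: each vertex `v` receives a set of `f v` colours, and exactly `t`
colours occur altogether. Since only finitely many colours are involved, they are taken in `ℕ`. -/
def IsListAssignment (f : V → ℕ) (t : ℕ) (L : V → Finset ℕ) : Prop :=
  (∀ v, (L v).card = f v) ∧ (Finset.univ.biUnion L).card = t

/-- The proper colouring `c` of `G` is an `L`-colouring. -/
def IsListColoring {G : SimpleGraph V} (L : V → Finset ℕ) (c : G.Coloring ℕ) : Prop :=
  ∀ v, c v ∈ L v

/-- `G` is uniquely `(f,t)`-list colourable. -/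
def UniquelyListColorableWith (G : SimpleGraph V) (f : V → ℕ) (t : ℕ) : Prop :=
  ∃ L : V → Finset ℕ, IsListAssignment f t L ∧ ∃! c : G.Coloring ℕ, IsListColoring L c

/-- `G` is uniquely `f`-list colourable. -/
def UniquelyListColorable (G : SimpleGraph V) (f : V → ℕ) : Prop :=
  ∃ t : ℕ, UniquelyListColorableWith G f t

/-- `χ_u(G,k)`: the least `t` such that `G` is uniquely `(k,t)`-list colourable, and `0` if there
is no such `t` (the infimum of the empty set of natural numbers is `0`). -/
noncomputable def uniqueListChromaticNumber (G : SimpleGraph V) (k : ℕ) : ℕ :=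
  sInf {t : ℕ | UniquelyListColorableWith G (fun _ => k) t}

end UniqueListColoring

/-! Write each list as `{c v, d v}`, with `c` a proper colouring. Recolouring `a` with `d a` forces
every neighbour `b` with `c b = d a` to be recoloured; regard this as an arc from `a` to `b`. The
colouring `c` is the only one exactly if from every vertex the arcs lead to both ends of some bad
edge, that is, an edge `xy` with `d x = d y` (`UniqueOn.exists_reach`, `uniqueOn_of_reach`). A core
is a set with second colours from which both ends of one bad edge are always reached. In a connected
graph the other second colours can be chosen along shortest walks into the core (`exists_flow`,
`Core.good`), and this works for any proper colouring `c`. So it suffices to find, for a uniquely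
2-list colourable graph and `t ≥ 3` with `t ≥ χ`, a `t`-colouring with a core. The lower bound `max
{3, χ} ≤ s` is elementary.

Unique colourability passes to one side of a cut vertex (`UniqueOn.subset_or`), and a core passes
from a side to the whole graph (`Core.of_side`). Hence the graph may be taken two-connected.
Counting arcs or following them shows that it is not complete, not complete bipartite, and has a
vertex with three neighbours.

In the bipartite case three colours suffice (`core_of_bipartite`): either there is no four-cycle, or
a maximal biclique has an outside neighbour. The non-bipartite case is `denseCore`, by induction on
`t`. For `t = 3`, a smallest third colour class gives a critical set with a single vertex of that
colour. This vertex can be moved freely around the set, which leads to a contradiction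
(`Special.false`). For the step, take a critical set avoiding one colour class. If there is no core,
all its outer neighbours lie in that class (`color_outer_nbr`) and are adjacent to the whole set
(`adj_of_outer_nbr`), so the graph is the set plus one dominating vertex; such a graph, not being
complete, has a core. -/

namespace UniqueListColoring

open Relation Classical

/-! ### Connectivity inside vertex sets -/

section Reach

variable {V : Type*} {G : SimpleGraph V} {U W Z : Set V} {x y z : V}

/-- `y` can be reached from `x` by a walk of `G` all of whose edges lie inside `U`. -/
def ReachIn (G : SimpleGraph V) (U : Set V) : V → V → Prop :=
  ReflTransGen fun a b => G.Adj a b ∧ a ∈ U ∧ b ∈ U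

/-- Any two vertices of `U` are joined by a walk inside `U`. -/
def ConnIn (G : SimpleGraph V) (U : Set V) : Prop :=
  ∀ x ∈ U, ∀ y ∈ U, ReachIn G U x y

/-- Deleting any one vertex leaves a connected graph. -/
def TwoConn (G : SimpleGraph V) : Prop :=
  ∀ w, ConnIn G {w}ᶜ

theorem ReachIn.refl (G : SimpleGraph V) (U : Set V) (x : V) : ReachIn G U x x := ReflTransGen.refl

theorem ReachIn.trans (h₁ : ReachIn G U x y) (h₂ : ReachIn G U y z) : ReachIn G U x z :=
  ReflTransGen.trans h₁ h₂

theorem ReachIn.symm (h : ReachIn G U x y) : ReachIn G U y x := by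
  induction h with
  | refl => exact ReflTransGen.refl
  | tail _ hbc ih => exact ReflTransGen.head ⟨hbc.1.symm, hbc.2.2, hbc.2.1⟩ ih

theorem ReachIn.of_adj (h : G.Adj x y) (hx : x ∈ U) (hy : y ∈ U) : ReachIn G U x y :=
  ReflTransGen.single ⟨h, hx, hy⟩

theorem ReachIn.mono (hUW : U ⊆ W) (h : ReachIn G U x y) : ReachIn G W x y :=
  ReflTransGen.mono (r := fun a b => G.Adj a b ∧ a ∈ U ∧ b ∈ U)
    (fun _ _ h => ⟨h.1, hUW h.2.1, hUW h.2.2⟩) x y h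

theorem ReachIn.mem (h : ReachIn G U x y) (hx : x ∈ U) : y ∈ U := by
  induction h with
  | refl => exact hx
  | tail _ h _ => exact h.2.2

/-- A walk which ends in `Z` has a first vertex in `Z`. -/
theorem ReachIn.exists_first (h : ReachIn G U x y) (hx : x ∈ U) (hxZ : x ∉ Z) (hy : y ∈ Z) :
    ∃ r s, ReachIn G (U \ Z) x r ∧ r ∈ U \ Z ∧ G.Adj r s ∧ s ∈ Z ∧ s ∈ U := by
  induction h using ReflTransGen.head_induction_on with
  | refl => exact absurd hy hxZ
  | @head a b hab hb ih =>
    by_cases hbZ : b ∈ Z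
    · exact ⟨a, b, .refl .., ⟨hx, hxZ⟩, hab.1, hbZ, hab.2.2⟩
    · obtain ⟨r, s, h1, h2⟩ := ih hab.2.2 hbZ
      exact ⟨r, s, (ReachIn.of_adj (U := U \ Z) hab.1 ⟨hx, hxZ⟩ ⟨hab.2.2, hbZ⟩).trans h1, h2⟩

/-- A walk from `x` to another vertex leaves `x` for the last time. -/
theorem ReachIn.exists_last_exit (h : ReachIn G U x y) (hx : x ∈ U) (hxy : x ≠ y) :
    ∃ q ∈ U, q ≠ x ∧ G.Adj x q ∧ ReachIn G (U \ {x}) q y := by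
  obtain ⟨r, s, h1, h2, h3, h4, h5⟩ :=
    h.symm.exists_first (Z := {x}) (h.mem hx) (by simpa using hxy.symm) rfl
  obtain rfl : s = x := h4
  exact ⟨r, h2.1, h2.2, h3.symm, h1.symm⟩

/-- The component of `x` inside `U`. -/
def compIn (G : SimpleGraph V) (U : Set V) (x : V) : Set V := {z | z ∈ U ∧ ReachIn G U x z}

theorem mem_compIn_self (hx : x ∈ U) : x ∈ compIn G U x := ⟨hx, .refl ..⟩

theorem compIn_closed (hy : y ∈ compIn G U x) (h : G.Adj y z) (hz : z ∈ U) : z ∈ compIn G U x :=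
  ⟨hz, hy.2.trans (.of_adj h hy.1 hz)⟩

theorem reachIn_compIn (h : ReachIn G U x y) (hx : x ∈ U) : ReachIn G (compIn G U x) x y := by
  induction h with
  | refl => exact .refl ..
  | tail hab hbc ih =>
    have hb := ReachIn.mem ih (mem_compIn_self hx)
    exact ih.trans (.of_adj hbc.1 hb (compIn_closed hb hbc.1 hbc.2.2))

theorem connIn_compIn (hx : x ∈ U) : ConnIn G (compIn G U x) := fun _ ha _ hb =>
  (reachIn_compIn ha.2 hx).symm.trans (reachIn_compIn hb.2 hx)

theorem ConnIn.insert_adj (h : ConnIn G U) (hx : x ∈ U) (hxy : G.Adj y x) :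
    ConnIn G (insert y U) := by
  have key : ∀ a ∈ insert y U, ReachIn G (insert y U) a x := by
    rintro a (rfl | ha)
    · exact .of_adj hxy (Set.mem_insert ..) (Set.mem_insert_of_mem _ hx)
    · exact (h a ha x hx).mono (Set.subset_insert ..)
  exact fun a ha b hb => (key a ha).trans (key b hb).symm

/-- If `x` reaches `y ≠ x` inside `U`, some connected set contains both, and remains connected after
deleting `x`. -/
theorem ReachIn.exists_connIn (h : ReachIn G U x y) (hx : x ∈ U) (hxy : x ≠ y) :
    ∃ T ⊆ U, x ∈ T ∧ y ∈ T ∧ ConnIn G T ∧ ConnIn G (T \ {x}) := by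
  obtain ⟨q, hq, hqx, hadj, hr⟩ := h.exists_last_exit hx hxy
  have hqU : q ∈ U \ {x} := ⟨hq, hqx⟩
  -- Here `q` follows the last visit to `x`, so its component without `x` contains `y`.
  refine ⟨insert x (compIn G (U \ {x}) q), ?_, Set.mem_insert .., .inr ⟨hr.mem hqU, hr⟩,
    (connIn_compIn hqU).insert_adj (mem_compIn_self hqU) hadj, ?_⟩
  · rintro z (rfl | hz)
    exacts [hx, hz.1.1]
  · rw [Set.insert_sdiff_of_mem _ (Set.mem_singleton x), Set.sdiff_singleton_eq_self fun h => h.1.2 rfl]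
    exact connIn_compIn hqU

/-- With `a` deleted, `y` still reaches `x`, and the first vertex of `X` on the way is `b`. Thus no
outer component is attached to `X` at `a` alone. -/
theorem TwoConn.exists_attachment (hG : TwoConn G) {X : Set V} {a : V} (hy : y ∉ X) (ha : a ∈ X)
    (hx : x ∈ X) (hxa : x ≠ a) :
    ∃ r b, ReachIn G Xᶜ y r ∧ r ∉ X ∧ G.Adj r b ∧ b ∈ X ∧ b ≠ a := by
  have hya : y ≠ a := fun h => hy (h ▸ ha)
  obtain ⟨r, s, h1, h2, h3, h4, h5⟩ := (hG a y hya x hxa).exists_first (Z := X) hya hy hx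
  exact ⟨r, s, h1.mono fun z hz => hz.2, h2.2, h3, h4, h5⟩

end Reach

/-! ### Cores -/

section Core

variable {V K : Type*} {G : SimpleGraph V} {c d : V → K} {S T U W Z : Set V}

/-- `c` is a proper colouring of `G`. -/
def Proper (G : SimpleGraph V) (c : V → K) : Prop := ∀ u v, G.Adj u v → c u ≠ c v

/-- Recolouring `a ∈ S` from `c a` to `d a` forces its neighbour `b` to be recoloured. -/
def ArcOn (G : SimpleGraph V) (c d : V → K) (S : Set V) (a b : V) : Prop :=
  a ∈ S ∧ G.Adj a b ∧ c b = d a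

/-- There are a set `S` and second colours on it such that recolouring any vertex of `S` forces both
ends of some edge to be recoloured with the same colour. -/
def HasCore (G : SimpleGraph V) (c : V → K) : Prop :=
  ∃ (d : V → K) (S : Set V) (x y : V), x ∈ S ∧ y ∈ S ∧ G.Adj x y ∧ d x = d y ∧
    ∀ s ∈ S, ReflTransGen (ArcOn G c d S) s x ∧ ReflTransGen (ArcOn G c d S) s y

/-- Some proper colouring of `G` with colours in `K` has a core. -/
def Core (G : SimpleGraph V) (K : Type*) : Prop := ∃ c : V → K, Proper G c ∧ HasCore G c

/-- The vertices of `W` from which `Z` can be reached inside `W`. -/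
def basin (G : SimpleGraph V) (W Z : Set V) : Set V :=
  {u | u ∈ W ∧ ∃ r z, ReachIn G W u r ∧ z ∈ Z ∧ G.Adj r z}

/-- There is a walk with `n` edges inside `W` from `u` to a neighbour of `Z`. -/
def Level (G : SimpleGraph V) (W Z : Set V) : ℕ → V → Prop
  | 0, u => u ∈ W ∧ ∃ z ∈ Z, G.Adj u z
  | n + 1, u => u ∈ W ∧ ∃ v, G.Adj u v ∧ Level G W Z n v

theorem Level.mem_basin : ∀ {n : ℕ} {u : V}, Level G W Z n u → u ∈ basin G W Z
  | 0, u, ⟨hu, z, hz, hadj⟩ => ⟨hu, u, z, .refl .., hz, hadj⟩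
  | n + 1, u, ⟨hu, v, hadj, hv⟩ => by
    obtain ⟨hvW, r, z, h1, h2, h3⟩ := hv.mem_basin
    exact ⟨hu, r, z, (ReachIn.of_adj hadj hu hvW).trans h1, h2, h3⟩

theorem exists_level {u : V} (hu : u ∈ basin G W Z) : ∃ n, Level G W Z n u := by
  obtain ⟨huW, r, z, h, hz, hadj⟩ := hu
  induction h using ReflTransGen.head_induction_on with
  | refl => exact ⟨0, huW, z, hz, hadj⟩
  | head hab _ ih =>
    obtain ⟨n, hn⟩ := ih hab.2.2
    exact ⟨n + 1, huW, _, hab.1, hn⟩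

/-- Second colours can be chosen on `basin G W Z` such that everything there flows into `Z`. -/
theorem exists_flow (G : SimpleGraph V) (W Z : Set V) :
    ∃ e : V → V, ∀ {K : Type*} (c d : V → K) (S : Set V),
      (∀ u ∈ basin G W Z, d u = c (e u)) → basin G W Z ⊆ S →
      ∀ u ∈ basin G W Z, ∃ z ∈ Z, ReflTransGen (ArcOn G c d S) u z := by
  -- The vertex `e u` lies in `Z` or has smaller least level than `u`. It depends on the graph
  -- alone, because `d` is later defined in terms of `e`.
  have key : ∀ u : V, ∃ v, ∀ h : ∃ n, Level G W Z n u,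
      G.Adj u v ∧ (v ∈ Z ∨ ∃ m < Nat.find h, Level G W Z m v) := by
    intro u
    by_cases h : ∃ n, Level G W Z n u
    · have hs := Nat.find_spec h
      rcases hn : Nat.find h with _ | m
      · rw [hn] at hs
        obtain ⟨_, z, hz, hadj⟩ := hs
        exact ⟨z, fun _ => ⟨hadj, .inl hz⟩⟩
      · rw [hn] at hs
        obtain ⟨_, v, hadj, hv⟩ := hs
        exact ⟨v, fun _ => ⟨hadj, .inr ⟨m, by omega, hv⟩⟩⟩
    · exact ⟨u, fun h' => absurd h' h⟩
  choose e he using key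
  refine ⟨e, fun c d S hd hS => ?_⟩
  have main : ∀ n u (h : ∃ n, Level G W Z n u), Nat.find h = n →
      ∃ z ∈ Z, ReflTransGen (ArcOn G c d S) u z := by
    intro n
    induction n using Nat.strong_induction_on with
    | _ n ih =>
      intro u h hn
      have hu : u ∈ basin G W Z := (Nat.find_spec h).mem_basin
      obtain ⟨hadj, hcase⟩ := he u h
      have harc : ArcOn G c d S u (e u) := ⟨hS hu, hadj, (hd u hu).symm⟩
      rcases hcase with hz | ⟨m, hm, hlev⟩
      · exact ⟨e u, hz, .single harc⟩
      · have hlt : Nat.find (⟨m, hlev⟩ : ∃ n, Level G W Z n (e u)) < n :=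
          lt_of_le_of_lt (Nat.find_min' _ hlev) (hn ▸ hm)
        obtain ⟨z, hz, hr⟩ := ih _ hlt (e u) _ rfl
        exact ⟨z, hz, .head harc hr⟩
  exact fun u hu => main _ u (exists_level hu) rfl

/-- Exchanging the two colours of a bicoloured set moves along any walk up to its end. -/
theorem ReachIn.arcs {α β : K} {u v : V} (h : ReachIn G T u v) (hc : Proper G c)
    (hT : ∀ z ∈ T, c z = α ∨ c z = β) (hd : ∀ z ∈ T, z ≠ v → d z = Equiv.swap α β (c z))
    (hS : T ⊆ S) : ReflTransGen (ArcOn G c d S) u v := by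
  induction h using ReflTransGen.head_induction_on with
  | refl => exact .refl
  | @head a b hab _ ih =>
    by_cases hav : a = v
    · rw [hav]
    · refine .head ⟨hS hab.2.1, hab.1, ?_⟩ ih
      have hne := hc _ _ hab.1
      rw [hd a hab.2.1 hav]
      rcases hT a hab.2.1 with h1 | h1 <;> rcases hT b hab.2.2 with h2 | h2 <;>
        simp_all

theorem mem_basin_of_reachIn {q r z : V} (h : ReachIn G W q r) (hq : q ∈ W) (hz : z ∈ Z)
    (hadj : G.Adj r z) : q ∈ basin G W Z := ⟨hq, r, z, h, hz, hadj⟩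

variable {α β : K} {p k l : V}

/-- A bicoloured connected set `T` together with a vertex `p` adjacent to both colours of `T` and a
walk from `T` to `p` which starts with one of the two colours. -/
theorem hasCore_of_exit (hc : Proper G c) (hT : ConnIn G T) (hTc : ∀ z ∈ T, c z = α ∨ c z = β)
    (hp : p ∉ T) (hk : k ∈ T) (hl : l ∈ T) (hpk : G.Adj p k) (hpl : G.Adj p l) (hck : c k = α)
    (hcl : c l = β) {s q : V} (hs : s ∈ T) (hsq : G.Adj s q) (hqc : c q = α ∨ c q = β)
    (hq : q ∉ T) (hqp : ReachIn G Tᶜ q p) : HasCore G c := by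
  have hqne : q ≠ p := by
    rintro rfl
    rcases hqc with h | h
    exacts [hc _ _ hpk (h.trans hck.symm), hc _ _ hpl (h.trans hcl.symm)]
  have hqB : q ∈ basin G (Tᶜ \ {p}) {p} := by
    obtain ⟨r, s, h1, -, h3, h4, -⟩ := hqp.exists_first (Z := {p}) hq (by simpa using hqne) rfl
    exact mem_basin_of_reachIn h1 ⟨hq, by simpa using hqne⟩ h4 h3
  obtain ⟨e, he⟩ := exists_flow G (Tᶜ \ {p}) {p}
  set B := basin G (Tᶜ \ {p}) {p} with hB
  -- The swap turns every edge inside `T` into arcs both ways. The arcs leave `T` from `s` to `q`,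
  -- flow to `p`, and return to `T` at `l`. The bad edge is `pk`, with common second colour `β`.
  let d : V → K := fun z => if z ∈ T then Equiv.swap α β (c z) else if z = p then β else c (e z)
  have hdT : ∀ z ∈ T, d z = Equiv.swap α β (c z) := fun z hz => if_pos hz
  have hdp : d p = β := by simp [d, hp]
  have hdB : ∀ z ∈ B, d z = c (e z) := fun z hz => by
    have h1 : z ∉ T := hz.1.1
    have h2 : z ≠ p := hz.1.2
    simp [d, h1, h2]
  let S : Set V := T ∪ B ∪ {p}
  have hTS : T ⊆ S := fun z hz => .inl (.inl hz)
  have hBS : B ⊆ S := fun z hz => .inl (.inr hz)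
  have hBp : ∀ u ∈ B, ReflTransGen (ArcOn G c d S) u p := fun u hu => by
    obtain ⟨z, rfl, h⟩ := he c d S hdB hBS u hu
    exact h
  have hTT : ∀ u ∈ T, ∀ v ∈ T, ReflTransGen (ArcOn G c d S) u v := fun u hu v hv =>
    (hT u hu v hv).arcs hc hTc (fun z hz _ => hdT z hz) hTS
  have hTp : ∀ u ∈ T, ReflTransGen (ArcOn G c d S) u p := fun u hu => by
    refine (hTT u hu s hs).trans (.head ⟨hTS hs, hsq, ?_⟩ (hBp q hqB))
    have hne := hc _ _ hsq
    rw [hdT s hs]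
    rcases hTc s hs with h1 | h1 <;> rcases hqc with h2 | h2 <;> simp_all
  have hpk' : ReflTransGen (ArcOn G c d S) p k :=
    .head ⟨.inr rfl, hpl, hcl.trans hdp.symm⟩ (hTT l hl k hk)
  have hall : ∀ u ∈ S, ReflTransGen (ArcOn G c d S) u p := by
    rintro u ((hu | hu) | rfl)
    exacts [hTp u hu, hBp u hu, .refl]
  refine ⟨d, S, p, k, .inr rfl, hTS hk, hpk, ?_, fun u hu => ⟨hall u hu, (hall u hu).trans hpk'⟩⟩
  rw [hdp, hdT k hk, hck, Equiv.swap_apply_left]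

/-- A bicoloured connected set `T` which stays connected without `k`, a vertex `p` adjacent to `k` and
to a vertex of the other colour, and a walk from `k` back to `T` which starts with the colour of
`p`. -/
theorem hasCore_of_return (hc : Proper G c) (hαβ : α ≠ β) (hT : ConnIn G T)
    (hTk : ConnIn G (T \ {k}))
    (hTc : ∀ z ∈ T, c z = α ∨ c z = β) (hp : p ∉ T) (hk : k ∈ T) (hl : l ∈ T) (hpk : G.Adj p k)
    (hpl : G.Adj p l) (hck : c k = α) (hcl : c l = β) {q r s : V} (hkq : G.Adj k q)
    (hqc : c q = c p) (hq : q ∉ insert p T) (hqr : ReachIn G (insert p T)ᶜ q r)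
    (hrs : G.Adj r s) (hs : s ∈ T) (hsk : s ≠ k) : HasCore G c := by
  have hlk : l ≠ k := by
    rintro rfl
    exact hαβ (hck.symm.trans hcl)
  have hqB : q ∈ basin G (insert p T)ᶜ (T \ {k}) :=
    mem_basin_of_reachIn hqr hq ⟨hs, hsk⟩ hrs
  obtain ⟨e, he⟩ := exists_flow G (insert p T)ᶜ (T \ {k})
  set B := basin G (insert p T)ᶜ (T \ {k}) with hB
  -- With the colour of `p` as second colour, `k` has arcs to both `p` and `q`; from `q` the flow
  -- enters `T \ {k}` and reaches `l`. Everything leads to `k`, and the bad edge is `pl`, with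
  -- common second colour `α`.
  let d : V → K := fun z => if z = k then c p else if z ∈ T then Equiv.swap α β (c z) else
    if z = p then α else c (e z)
  have hdk : d k = c p := by simp [d]
  have hdT : ∀ z ∈ T, z ≠ k → d z = Equiv.swap α β (c z) := fun z hz hzk => by simp [d, hz, hzk]
  have hdp : d p = α := by simp [d, hp, hpk.ne]
  have hdB : ∀ z ∈ B, d z = c (e z) := fun z hz => by
    have h1 : z ∉ T := fun h => hz.1 (.inr h)
    have h2 : z ≠ p := fun h => hz.1 (.inl h)
    have h3 : z ≠ k := fun h => h1 (h ▸ hk)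
    simp [d, h1, h2, h3]
  let S : Set V := T ∪ B ∪ {p}
  have hTS : T ⊆ S := fun z hz => .inl (.inl hz)
  have hBS : B ⊆ S := fun z hz => .inl (.inr hz)
  have hTk' : ∀ u ∈ T, ReflTransGen (ArcOn G c d S) u k := fun u hu =>
    (hT u hu k hk).arcs hc hTc (fun z hz h => hdT z hz h) hTS
  have hTl : ∀ u ∈ T, u ≠ k → ReflTransGen (ArcOn G c d S) u l := fun u hu huk =>
    (hTk u ⟨hu, huk⟩ l ⟨hl, hlk⟩).arcs hc (fun z hz => hTc z hz.1)
      (fun z hz _ => hdT z hz.1 hz.2) (Set.sdiff_subset.trans hTS)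
  have hkl : ReflTransGen (ArcOn G c d S) k l := by
    obtain ⟨z, hz, h⟩ := he c d S hdB hBS q hqB
    exact .head ⟨hTS hk, hkq, hqc.trans hdk.symm⟩ (h.trans (hTl z hz.1 hz.2))
  have hkp : ReflTransGen (ArcOn G c d S) k p := .single ⟨hTS hk, hpk.symm, hdk.symm⟩
  have hall : ∀ u ∈ S, ReflTransGen (ArcOn G c d S) u k := by
    rintro u ((hu | hu) | rfl)
    · exact hTk' u hu
    · obtain ⟨z, hz, h⟩ := he c d S hdB hBS u hu
      exact h.trans (hTk' z hz.1)
    · exact .single ⟨.inr rfl, hpk, hck.trans hdp.symm⟩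
  refine ⟨d, S, p, l, .inr rfl, hTS hl, hpl, ?_,
    fun u hu => ⟨(hall u hu).trans hkp, (hall u hu).trans hkl⟩⟩
  rw [hdp, hdT l hl hlk, hcl, Equiv.swap_apply_right]

/-- A bicoloured connected set `T`, a vertex `p` adjacent to both colours of `T`, and a walk from `p`
to its neighbour `k` in `T` which starts with the colour that `k` does not have. -/
theorem hasCore_of_detour (hc : Proper G c) (hαβ : α ≠ β) (hT : ConnIn G T)
    (hTc : ∀ z ∈ T, c z = α ∨ c z = β) (hp : p ∉ T) (hk : k ∈ T) (hl : l ∈ T) (hpk : G.Adj p k)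
    (hpl : G.Adj p l) (hck : c k = α) (hcl : c l = β) {y r : V} (hpy : G.Adj p y)
    (hyc : c y = β) (hy : y ∉ insert p T) (hyr : ReachIn G (insert p T)ᶜ y r)
    (hrk : G.Adj r k) : HasCore G c := by
  have hkl : k ≠ l := by
    rintro rfl
    exact hαβ (hck.symm.trans hcl)
  have hyB : y ∈ basin G (insert p T)ᶜ {k} := mem_basin_of_reachIn hyr hy rfl hrk
  obtain ⟨e, he⟩ := exists_flow G (insert p T)ᶜ {k}
  set B := basin G (insert p T)ᶜ {k} with hB
  -- Now `T` drains through `l` to `p`, and `p` leads by `y` and the flow to `k`. The bad edge is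
  -- `pk`, with common second colour `β`.
  let d : V → K := fun z => if z = l then c p else if z ∈ T then Equiv.swap α β (c z) else
    if z = p then β else c (e z)
  have hdl : d l = c p := by simp [d]
  have hdT : ∀ z ∈ T, z ≠ l → d z = Equiv.swap α β (c z) := fun z hz hzk => by simp [d, hz, hzk]
  have hdp : d p = β := by simp [d, hp, hpl.ne]
  have hdB : ∀ z ∈ B, d z = c (e z) := fun z hz => by
    have h1 : z ∉ T := fun h => hz.1 (.inr h)
    have h2 : z ≠ p := fun h => hz.1 (.inl h)
    have h3 : z ≠ l := fun h => h1 (h ▸ hl)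
    simp [d, h1, h2, h3]
  let S : Set V := T ∪ B ∪ {p}
  have hTS : T ⊆ S := fun z hz => .inl (.inl hz)
  have hBS : B ⊆ S := fun z hz => .inl (.inr hz)
  have hTp : ∀ u ∈ T, ReflTransGen (ArcOn G c d S) u p := fun u hu =>
    ((hT u hu l hl).arcs hc hTc (fun z hz h => hdT z hz h) hTS).tail
      ⟨hTS hl, hpl.symm, hdl.symm⟩
  have hBk : ∀ u ∈ B, ReflTransGen (ArcOn G c d S) u k := fun u hu => by
    obtain ⟨z, rfl, h⟩ := he c d S hdB hBS u hu
    exact h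
  have hpk' : ReflTransGen (ArcOn G c d S) p k :=
    .head ⟨.inr rfl, hpy, hyc.trans hdp.symm⟩ (hBk y hyB)
  have hall : ∀ u ∈ S, ReflTransGen (ArcOn G c d S) u p := by
    rintro u ((hu | hu) | rfl)
    exacts [hTp u hu, (hBk u hu).trans (hTp k hk), .refl]
  refine ⟨d, S, p, k, .inr rfl, hTS hk, hpk, ?_, fun u hu => ⟨hall u hu, (hall u hu).trans hpk'⟩⟩
  rw [hdp, hdT k hk hkl, hck, Equiv.swap_apply_left]

/-- Two adjacent vertices `x`, `y` on a closed walk whose successors have the same colour. -/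
theorem hasCore_of_chord {x y x₁ y₁ y₂ r : V} {W : Set V} (hxy : G.Adj x y) (hx₁ : G.Adj x x₁)
    (hy₁ : G.Adj y y₁) (hy₂ : G.Adj y₁ y₂) (hyx : G.Adj y₂ x) (hcol : c x₁ = c y₁) (hxy₁ : x ≠ y₁)
    (hyy₂ : y ≠ y₂) (hW : ∀ z ∈ W, z ≠ x ∧ z ≠ y ∧ z ≠ y₁ ∧ z ≠ y₂) (hxW : x₁ ∈ W)
    (hr : ReachIn G W x₁ r) (hry : G.Adj r y) : HasCore G c := by
  have hxB : x₁ ∈ basin G W {y} := mem_basin_of_reachIn hr hxW rfl hry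
  obtain ⟨e, he⟩ := exists_flow G W {y}
  set B := basin G W {y} with hB
  let d : V → K := fun z => if z = x ∨ z = y then c x₁ else if z = y₁ then c y₂ else
    if z = y₂ then c x else c (e z)
  have hdx : d x = c x₁ := by simp [d]
  have hdy : d y = c x₁ := by simp [d]
  have hdy₁ : d y₁ = c y₂ := by simp [d, hxy₁.symm, hy₁.ne']
  have hdy₂ : d y₂ = c x := by simp [d, hyy₂.symm, hyx.ne, hy₂.ne']
  have hdB : ∀ z ∈ B, d z = c (e z) := fun z hz => by
    obtain ⟨h1, h2, h3, h4⟩ := hW z hz.1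
    simp [d, h1, h2, h3, h4]
  let S : Set V := {x, y, y₁, y₂} ∪ B
  have hBS : B ⊆ S := fun z hz => .inr hz
  have hy2 : ReflTransGen (ArcOn G c d S) y₂ x := .single ⟨by simp [S], hyx, hdy₂.symm⟩
  have hy1 : ReflTransGen (ArcOn G c d S) y₁ x := .head ⟨by simp [S], hy₂, hdy₁.symm⟩ hy2
  have hy0 : ReflTransGen (ArcOn G c d S) y x :=
    .head ⟨by simp [S], hy₁, hcol.symm.trans hdy.symm⟩ hy1
  have hBy : ∀ u ∈ B, ReflTransGen (ArcOn G c d S) u y := fun u hu => by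
    obtain ⟨z, rfl, h⟩ := he c d S hdB hBS u hu
    exact h
  have hx0 : ReflTransGen (ArcOn G c d S) x y := .head ⟨by simp [S], hx₁, hdx.symm⟩ (hBy x₁ hxB)
  have hall : ∀ u ∈ S, ReflTransGen (ArcOn G c d S) u x := by
    rintro u ((rfl | rfl | rfl | rfl) | hu)
    exacts [.refl, hy0, hy1, hy2, (hBy u hu).trans hy0]
  exact ⟨d, S, x, y, by simp [S], by simp [S], hxy, hdx.trans hdy.symm,
    fun u hu => ⟨hall u hu, (hall u hu).trans hx0⟩⟩

/-- A four-cycle `x y x' y'` with `y`, `y'` coloured alike, and a walk from `x` to `x'` which starts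
with the colour of `x'`. -/
theorem hasCore_of_twins {x x' y y' e₀ r : V} {W : Set V} (hxy : G.Adj x y) (hxy' : G.Adj x y')
    (hx'y : G.Adj x' y) (hx'y' : G.Adj x' y') (hxe : G.Adj x e₀) (hcol : c e₀ = c x')
    (hcy : c y = c y') (hxx' : x ≠ x') (hyy' : y ≠ y')
    (hW : ∀ z ∈ W, z ≠ x ∧ z ≠ x' ∧ z ≠ y ∧ z ≠ y') (heW : e₀ ∈ W)
    (hr : ReachIn G W e₀ r) (hrx : G.Adj r x') : HasCore G c := by
  have heB : e₀ ∈ basin G W {x'} := mem_basin_of_reachIn hr heW rfl hrx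
  obtain ⟨e, he⟩ := exists_flow G W {x'}
  set B := basin G W {x'} with hB
  -- The single choice `d x' = c y` gives arcs from `x'` to both `y` and `y'`. The bad edge is
  -- `xy'`, both ends of which have the colour of `x'` as second colour.
  let d : V → K := fun z => if z = x then c e₀ else if z = x' then c y else if z = y then c x else
    if z = y' then c x' else c (e z)
  have hdx : d x = c e₀ := by simp [d]
  have hdx' : d x' = c y := by simp [d, hxx'.symm]
  have hdy : d y = c x := by simp [d, hxy.ne', hx'y.ne']
  have hdy' : d y' = c x' := by simp [d, hxy'.ne', hx'y'.ne', hyy'.symm]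
  have hdB : ∀ z ∈ B, d z = c (e z) := fun z hz => by
    obtain ⟨h1, h2, h3, h4⟩ := hW z hz.1
    simp [d, h1, h2, h3, h4]
  let S : Set V := {x, x', y, y'} ∪ B
  have hBS : B ⊆ S := fun z hz => .inr hz
  have hBx : ∀ u ∈ B, ReflTransGen (ArcOn G c d S) u x' := fun u hu => by
    obtain ⟨z, rfl, h⟩ := he c d S hdB hBS u hu
    exact h
  have h1 : ReflTransGen (ArcOn G c d S) x x' := .head ⟨by simp [S], hxe, hdx.symm⟩ (hBx e₀ heB)
  have h2 : ReflTransGen (ArcOn G c d S) y x := .single ⟨by simp [S], hxy.symm, hdy.symm⟩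
  have h3 : ReflTransGen (ArcOn G c d S) y' x' := .single ⟨by simp [S], hx'y'.symm, hdy'.symm⟩
  have h4 : ReflTransGen (ArcOn G c d S) x' y' :=
    .single ⟨by simp [S], hx'y', hcy.symm.trans hdx'.symm⟩
  have h5 : ReflTransGen (ArcOn G c d S) x' x := .head ⟨by simp [S], hx'y, hdx'.symm⟩ h2
  have hall : ∀ u ∈ S, ReflTransGen (ArcOn G c d S) u x' := by
    rintro u ((rfl | rfl | rfl | rfl) | hu)
    exacts [h1, .refl, h2.trans h1, h3, hBx u hu]
  exact ⟨d, S, x, y', by simp [S], by simp [S], hxy', hdx.trans (hcol.trans hdy'.symm),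
    fun u hu => ⟨(hall u hu).trans h5, (hall u hu).trans h4⟩⟩

end Core

/-! ### Bipartite graphs -/

section Bipartite

variable {V K : Type*} {G : SimpleGraph V}

/-- A vertex `w` with neighbours `z`, `b`, `b'`, where `z` has a further neighbour of the colour of `w`
from which one gets to `b` and then to `b'` inside a bicoloured set. -/
theorem hasCore_of_star {c : V → K} (hc : Proper G c) {E : Set V} {α β : K}
    {w z b b' w' b'' e : V} (hE : ConnIn G E) (hEc : ∀ v ∈ E, c v = α ∨ c v = β)
    (hwE : w ∉ E) (hzE : z ∉ E) (hw'E : w' ∉ E) (hb'E : b' ∉ E) (hb : b ∈ E) (hb'' : b'' ∈ E)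
    (he : e ∈ E) (hwz : G.Adj w z) (hwb : G.Adj w b) (hwb' : G.Adj w b') (hzw' : G.Adj z w')
    (hw'b : G.Adj w' b'') (heb : G.Adj e b') (hww' : w ≠ w') (hb'z : b' ≠ z)
    (hcz : c z = α) (hcw : c w' = c w) (hcb : c b = β) (hcb'' : c b'' = β) (hcb' : c b' = β) :
    HasCore G c := by
  have hb'w' : b' ≠ w' := by
    rintro rfl
    exact hc _ _ hw'b (hcb'.trans hcb''.symm)
  -- The arcs run from `w` to `z`, `w'`, `b''`, through `E` to `e`, then to `b'` and back to `w`.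
  -- The bad edge is `wb`, with common second colour `α`; the default value `c w` serves `z` and
  -- `b'`.
  let d : V → K := fun v => if v ∈ E then Equiv.swap α β (c v) else if v = w then α else
    if v = w' then β else c w
  have hdE : ∀ v ∈ E, d v = Equiv.swap α β (c v) := fun v hv => if_pos hv
  have hdw : d w = α := by simp [d, hwE]
  have hdw' : d w' = β := by simp [d, hw'E, hww'.symm]
  have hdz : d z = c w := by simp [d, hzE, hwz.ne', hzw'.ne]
  have hdb' : d b' = c w := by simp [d, hb'E, hwb'.ne', hb'w']
  let S : Set V := E ∪ {w, z, w', b'}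
  have hES : E ⊆ S := fun v hv => .inl hv
  have hEE : ∀ u ∈ E, ∀ v ∈ E, ReflTransGen (ArcOn G c d S) u v := fun u hu v hv =>
    (hE u hu v hv).arcs hc hEc (fun x hx _ => hdE x hx) hES
  have hce : c b' = d e := by
    rw [hdE e he, (hEc e he).resolve_right fun h => hc _ _ heb (h.trans hcb'.symm),
      Equiv.swap_apply_left, hcb']
  have h1 : ReflTransGen (ArcOn G c d S) b' w := .single ⟨by simp [S], hwb'.symm, hdb'.symm⟩
  have h2 : ∀ u ∈ E, ReflTransGen (ArcOn G c d S) u w := fun u hu =>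
    (hEE u hu e he).trans (.head ⟨hES he, heb, hce⟩ h1)
  have h3 : ReflTransGen (ArcOn G c d S) w' b'' :=
    .single ⟨by simp [S], hw'b, hcb''.trans hdw'.symm⟩
  have h4 : ReflTransGen (ArcOn G c d S) z b'' :=
    .head ⟨by simp [S], hzw', hcw.trans hdz.symm⟩ h3
  have h5 : ReflTransGen (ArcOn G c d S) w b :=
    (ReflTransGen.head ⟨by simp [S], hwz, hcz.trans hdw.symm⟩ h4).trans (hEE _ hb'' _ hb)
  have hall : ∀ u ∈ S, ReflTransGen (ArcOn G c d S) u w := by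
    rintro u (hu | rfl | rfl | rfl | rfl)
    exacts [h2 u hu, .refl, h4.trans (h2 _ hb''), h3.trans (h2 _ hb''), h1]
  refine ⟨d, S, w, b, by simp [S], hES hb, hwb, ?_,
    fun u hu => ⟨hall u hu, (hall u hu).trans h5⟩⟩
  rw [hdw, hdE b hb, hcb, Equiv.swap_apply_right]

/-- The two sides of a bipartite graph as two of three colours. -/
def sideColor (b : Bool) : Fin 3 := if b then 1 else 0

theorem sideColor_injective : Function.Injective sideColor := by decide

theorem sideColor_ne_two (b : Bool) : sideColor b ≠ 2 := by revert b; decide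

theorem bool_eq_of_ne_of_ne {a b c : Bool} (h : a ≠ b) (h' : b ≠ c) : a = c := by
  revert a b c; decide

variable {f : V → Bool}

theorem proper_recolor_pair (hf : Proper G f) {u v : V} (huv : ¬ G.Adj u v) :
    Proper G fun z => if z = u ∨ z = v then 2 else sideColor (f z) := by
  intro x y hxy
  have h1 := sideColor_ne_two (f x)
  have h2 := sideColor_ne_two (f y)
  have h3 : sideColor (f x) ≠ sideColor (f y) := fun h => hf _ _ hxy (sideColor_injective h)
  by_cases hx : x = u ∨ x = v <;> by_cases hy : y = u ∨ y = v <;> simp only [hx, hy, if_true,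
    if_false]
  · rcases hx with rfl | rfl <;> rcases hy with rfl | rfl
    · exact absurd hxy (G.loopless.irrefl _)
    · exact absurd hxy huv
    · exact absurd hxy.symm huv
    · exact absurd hxy (G.loopless.irrefl _)
  · exact h2.symm
  · exact h1
  · exact h3

/-- Once all neighbours of `z` have the third colour, `z` is free to take the colour of the opposite
side. -/
theorem proper_recolor_neighbors (hf : Proper G f) (z : V) :
    Proper G fun v => if G.Adj z v then 2 else if v = z then sideColor (!f z)
      else sideColor (f v) := by
  intro x y hxy
  have h1 := sideColor_ne_two (f x)
  have h2 := sideColor_ne_two (f y)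
  have h0 := sideColor_ne_two (!f z)
  have h3 : sideColor (f x) ≠ sideColor (f y) := fun h => hf _ _ hxy (sideColor_injective h)
  have hno : ¬ (G.Adj z x ∧ G.Adj z y) := fun h =>
    hf _ _ hxy (bool_eq_of_ne_of_ne (hf _ _ h.1.symm) (hf _ _ h.2))
  by_cases hx : G.Adj z x
  · have hy : ¬ G.Adj z y := fun h => hno ⟨hx, h⟩
    simp only [hx, hy, if_true, if_false]
    split_ifs
    exacts [h0.symm, h2.symm]
  · have hyz : y ≠ z := by
      rintro rfl
      exact hx hxy.symm
    by_cases hy : G.Adj z y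
    · simp only [hx, hy, if_true, if_false]
      split_ifs
      exacts [h0, h1]
    · have hxz : x ≠ z := by
        rintro rfl
        exact hy hxy
      simp only [hx, hy, hxz, hyz, if_false]
      exact h3

/-- The vertices at distance at least two from `z`. -/
def farFrom (G : SimpleGraph V) (z : V) : Set V := {v | v ≠ z ∧ ¬ G.Adj z v}

/-- With `w` deleted, `b` still reaches `z`. Vertices of `farFrom G z` are not adjacent to `z`, so
the walk leaves this set at a neighbour of `z` other than `w`. -/
theorem TwoConn.exists_step_to_neighbor (hG : TwoConn G) {w z b : V} (hwz : G.Adj w z)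
    (hbw : b ≠ w) (hb : b ∈ farFrom G z) :
    ∃ r w', ReachIn G (farFrom G z) b r ∧ r ∈ farFrom G z ∧ G.Adj r w' ∧ G.Adj z w' ∧ w' ≠ w := by
  obtain ⟨r, s, h1, h2, h3, h4, h5⟩ := (hG w b hbw z hwz.ne').exists_first
    (Z := (farFrom G z)ᶜ) hbw (fun h => h hb) (fun h => h.1 rfl)
  have h2' : r ∈ farFrom G z := not_not.1 h2.2
  refine ⟨r, s, h1.mono fun v hv => not_not.1 hv.2, h2', h3, ?_, h5⟩
  by_contra hzs
  have : s = z := by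
    by_contra hsz
    exact h4 ⟨hsz, hzs⟩
  exact h2'.2 (this ▸ h3.symm)

/-- After `proper_recolor_neighbors` the set `farFrom G z` is bicoloured, while `w` and a second
neighbour `w'` of `z` share the third colour. A component of this set with one of `b`, `b'` removed
then plays the role of `E` in `hasCore_of_star`. -/
theorem core_of_reach_far (hG : TwoConn G) (hf : Proper G f) {w z b b' : V} (hwz : G.Adj w z)
    (hwb : G.Adj w b) (hwb' : G.Adj w b') (hbz : b ≠ z) (hb'z : b' ≠ z) (hbb' : b ≠ b')
    (hr : ReachIn G (farFrom G z) b b') : Core G (Fin 3) := by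
  have hfbz : ∀ v, G.Adj w v → f v = f z := fun v hv =>
    bool_eq_of_ne_of_ne (hf _ _ hv.symm) (hf _ _ hwz)
  have hnadj : ∀ v, f v = f z → ¬ G.Adj z v := fun v hv h => hf _ _ h hv.symm
  have hbF : b ∈ farFrom G z := ⟨hbz, hnadj b (hfbz b hwb)⟩
  have hb'F : b' ∈ farFrom G z := ⟨hb'z, hnadj b' (hfbz b' hwb')⟩
  obtain ⟨b'', w', h1, hb''F, h3, h4, h5⟩ := hG.exists_step_to_neighbor hwz hwb.ne' hbF
  have hfb'' : f b'' = f z := bool_eq_of_ne_of_ne (hf _ _ h3) (hf _ _ h4.symm)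
  have key : ∀ b b', G.Adj w b → G.Adj w b' → b' ≠ z → b' ∈ farFrom G z →
      ReachIn G (farFrom G z) b'' b' → b'' ≠ b' → ReachIn G (farFrom G z \ {b'}) b'' b →
      Core G (Fin 3) := by
    intro b b' hwb hwb' hb'z hb'F hr' hne hr
    obtain ⟨e, s, h6, h7, h8, h9, -⟩ := hr'.exists_first (Z := {b'}) hb''F (by simpa using hne) rfl
    obtain rfl : s = b' := h9
    have hmem : b'' ∈ farFrom G z \ {s} := ⟨hb''F, hne⟩
    have hE : ∀ v ∈ compIn G (farFrom G z \ {s}) b'', v ∈ farFrom G z := fun v hv => hv.1.1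
    refine ⟨_, proper_recolor_neighbors hf z, hasCore_of_star (proper_recolor_neighbors hf z)
      (E := compIn G (farFrom G z \ {s}) b'') (α := sideColor (!f z)) (β := sideColor (f z))
      (connIn_compIn hmem) ?_ (fun h => (hE _ h).2 hwz.symm) (fun h => (hE _ h).1 rfl)
      (fun h => (hE _ h).2 h4) (fun h => h.1.2 rfl) ⟨hr.mem hmem, hr⟩ (mem_compIn_self hmem)
      ⟨h7, h6⟩ hwz hwb hwb' h4 h3.symm h8 h5.symm hb'z ?_ ?_ ?_ ?_ ?_⟩
    · intro v hv
      obtain ⟨ha, hb⟩ := hE v hv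
      simp only [ha, hb, if_false]
      rcases Bool.eq_or_eq_not (f v) (f z) with h | h
      · exact .inr (by rw [h])
      · exact .inl (by rw [h])
    · simp
    · simp [h4, hwz.symm]
    · have := (hE b ⟨hr.mem hmem, hr⟩)
      simp [this.1, this.2, hfbz b hwb]
    · simp [hb''F.1, hb''F.2, hfb'']
    · simp [hb'F.1, hb'F.2, hfbz s hwb']
  -- The one of `b`, `b'` that is met first from `b''` stays in `E`; the other is deleted.
  by_cases hb1 : b'' = b'
  · exact key b' b hwb' hwb hbz hbF h1.symm (fun h => hbb' (h ▸ hb1)) (hb1 ▸ .refl ..)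
  by_cases hb2 : b'' = b
  · exact key b b' hwb hwb' hb'z hb'F (hb2 ▸ hr) hb1 (hb2 ▸ .refl ..)
  obtain ⟨r, s, h6, h7, h8, h9, h10⟩ := h1.symm.exists_first (Z := {b, b'}) hb''F
    (by simp [hb1, hb2]) (by simp)
  have hr7 : r ≠ b ∧ r ≠ b' := by simpa using h7.2
  rcases h9 with rfl | rfl
  · exact key s b' hwb hwb' hb'z hb'F (h1.symm.trans hr) hb1
      ((h6.mono (W := farFrom G z \ {b'}) fun v hv => ⟨hv.1, fun h => hv.2 (.inr h)⟩).trans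
        (.of_adj h8 ⟨h7.1, hr7.2⟩ ⟨h10, hbb'⟩))
  · exact key s b hwb' hwb hbz hbF h1.symm hb2
      ((h6.mono (W := farFrom G z \ {b}) fun v hv => ⟨hv.1, fun h => hv.2 (.inl h)⟩).trans
        (.of_adj h8 ⟨h7.1, hr7.1⟩ ⟨h10, hbb'.symm⟩))

/-- If `b` and `b'` are separated far from `z`, exchange the roles of `z` and `b`. The component of
`b'` stays away from `b` and leads to a neighbour `w₂ ≠ w` of `z`. Adjacency of `w₂` and `b` would
close a four-cycle, so `b'` reaches `z` far from `b`. -/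
theorem core_of_bipartite_of_no_square (hG : TwoConn G) (hf : Proper G f)
    (hsq : ∀ x x' y y', x ≠ x' → y ≠ y' → G.Adj x y → G.Adj x y' → G.Adj x' y → G.Adj x' y' → False)
    {w z b b' : V} (hwz : G.Adj w z) (hwb : G.Adj w b) (hwb' : G.Adj w b') (hbz : b ≠ z)
    (hb'z : b' ≠ z) (hbb' : b ≠ b') : Core G (Fin 3) := by
  by_cases hr : ReachIn G (farFrom G z) b b'
  · exact core_of_reach_far hG hf hwz hwb hwb' hbz hb'z hbb' hr
  have hfbz : ∀ v, G.Adj w v → f v = f z := fun v hv =>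
    bool_eq_of_ne_of_ne (hf _ _ hv.symm) (hf _ _ hwz)
  have hnadj : ∀ v, f v = f z → ¬ G.Adj z v := fun v hv h => hf _ _ h hv.symm
  have hbF : b ∈ farFrom G z := ⟨hbz, hnadj b (hfbz b hwb)⟩
  have hb'F : b' ∈ farFrom G z := ⟨hb'z, hnadj b' (hfbz b' hwb')⟩
  obtain ⟨r, w₂, h1, h2, h3, h4, h5⟩ := hG.exists_step_to_neighbor hwz hwb'.ne' hb'F
  have hsub : compIn G (farFrom G z) b' ⊆ farFrom G b := by
    intro v hv
    refine ⟨fun h => hr (h ▸ hv.2.symm), fun h => hr ?_⟩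
    exact (ReachIn.of_adj h hbF hv.1).trans hv.2.symm
  have hrF : ReachIn G (farFrom G b) b' r := (reachIn_compIn h1 hb'F).mono hsub
  have hw₂F : w₂ ∈ farFrom G b := ⟨fun h => hbF.2 (h ▸ h4), fun h =>
    hsq w w₂ z b h5.symm hbz.symm hwz hwb h4.symm h.symm⟩
  have hzF : z ∈ farFrom G b := ⟨hbz.symm, fun h => hbF.2 h.symm⟩
  refine core_of_reach_far hG hf (z := b) (b := z) (b' := b') hwb hwz hwb' hbz.symm hbb'.symm
    hb'z.symm (ReachIn.symm ?_)
  exact (hrF.trans (.of_adj h3 (hsub ⟨h2, h1⟩) hw₂F)).trans (.of_adj h4.symm hw₂F hzF)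

/-- A maximal complete bipartite subgraph with at least two vertices on each side which has a
further neighbour. -/
theorem core_of_biclique (hG : TwoConn G) (hf : Proper G f) {X Y : Set V} {s : Bool}
    (hX : ∀ x ∈ X, f x = s) (hY : ∀ y ∈ Y, f y = !s) (hXY : ∀ x ∈ X, ∀ y ∈ Y, G.Adj x y)
    (hX2 : X.Nontrivial) (hY2 : Y.Nontrivial)
    (hmax : ∀ e, (∀ x ∈ X, G.Adj e x) → e ∈ Y) {e x : V} (he : e ∉ Y) (hx : x ∈ X)
    (hex : G.Adj e x) : Core G (Fin 3) := by
  have heX : e ∉ X := fun h => hf _ _ hex ((hX e h).trans (hX x hx).symm)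
  have hdisj : ∀ v ∈ X, v ∉ Y := fun v hv hv' => by
    have := (hX v hv).symm.trans (hY v hv')
    cases s <;> simp at this
  have hne : ∀ u ∈ X, ∀ v ∈ Y, u ≠ v := fun u hu v hv h => hdisj u hu (h ▸ hv)
  by_cases h2 : ∃ x' ∈ X, x' ≠ x ∧ G.Adj e x'
  · obtain ⟨x', hx', hx'x, hex'⟩ := h2
    obtain ⟨x'', hx'', hex''⟩ : ∃ x'' ∈ X, ¬ G.Adj e x'' := by
      by_contra hcon
      push Not at hcon
      exact he (hmax e hcon)
    obtain ⟨y, hy, y', hy', hyy'⟩ := hY2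
    have hx''x : x'' ≠ x := fun h => hex'' (h ▸ hex)
    have hx''x' : x'' ≠ x' := fun h => hex'' (h ▸ hex')
    have hey : e ≠ y := fun h => he (h ▸ hy)
    have hey' : e ≠ y' := fun h => he (h ▸ hy')
    -- The closed walk is `x e x' y' x'' y`, and the bad edge `xy'` is its chord: the successors `e`
    -- and `x''` of its ends both receive the third colour.
    refine ⟨_, proper_recolor_pair hf hex'', hasCore_of_chord (x := x) (y := y') (x₁ := e)
      (y₁ := x'') (y₂ := y) (r := x') (W := {e, x'}) (hXY x hx y' hy') hex.symm
      (hXY x'' hx'' y' hy').symm (hXY x'' hx'' y hy) (hXY x hx y hy).symm (by simp) hx''x.symm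
      hyy'.symm ?_ (by simp) (.of_adj hex' (by simp) (by simp)) (hXY x' hx' y' hy')⟩
    rintro v (rfl | rfl)
    · exact ⟨hex.ne, hey', fun h => heX (h ▸ hx''), hey⟩
    · exact ⟨hx'x, hne _ hx' _ hy', hx''x'.symm, hne _ hx' _ hy⟩
  -- Here `x` is the only neighbour of `e` in `X`, so `e` may share the third colour with any other
  -- vertex of `X`. A walk from `e` returns at some `u ≠ x`; the twin configuration serves `u ∈ X`,
  -- the chord configuration `u ∈ Y`.
  · push Not at h2
    have heU : e ∉ X ∪ Y := fun h => h.elim heX he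
    obtain ⟨x', hx', hx'x⟩ := hX2.exists_ne x
    obtain ⟨r, u, h3, h4, h5, h6, h7⟩ := hG.exists_attachment (X := X ∪ Y) (a := x) heU (.inl hx)
      (.inl hx') hx'x
    have hW : ∀ z ∈ (X ∪ Y)ᶜ, ∀ v ∈ X ∪ Y, z ≠ v := fun z hz v hv h => hz (h ▸ hv)
    rcases h6 with h6 | h6
    · obtain ⟨y, hy, y', hy', hyy'⟩ := hY2
      have hnadj : ¬ G.Adj e u := h2 u h6 h7
      refine ⟨_, proper_recolor_pair hf hnadj, hasCore_of_twins (x := x) (x' := u) (y := y)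
        (y' := y') (e₀ := e) (r := r) (W := (X ∪ Y)ᶜ) (hXY x hx y hy) (hXY x hx y' hy')
        (hXY u h6 y hy) (hXY u h6 y' hy') hex.symm (by simp) ?_ h7.symm hyy' ?_ heU h3 h5⟩
      · have a1 : y ≠ e := fun h => he (h ▸ hy)
        have a2 : y' ≠ e := fun h => he (h ▸ hy')
        simp [a1, a2, (hne _ h6 _ hy).symm, (hne _ h6 _ hy').symm, hY y hy, hY y' hy']
      · exact fun z hz => ⟨hW z hz _ (.inl hx), hW z hz _ (.inl h6), hW z hz _ (.inr hy),
          hW z hz _ (.inr hy')⟩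
    · obtain ⟨y', hy', hy'u⟩ := hY2.exists_ne u
      have hnadj : ¬ G.Adj e x' := h2 x' hx' hx'x
      refine ⟨_, proper_recolor_pair hf hnadj, hasCore_of_chord (x := x) (y := u) (x₁ := e)
        (y₁ := x') (y₂ := y') (r := r) (W := (X ∪ Y)ᶜ) (hXY x hx u h6) hex.symm
        (hXY x' hx' u h6).symm (hXY x' hx' y' hy') (hXY x hx y' hy').symm (by simp) hx'x.symm
        hy'u.symm ?_ heU h3 h5⟩
      exact fun z hz => ⟨hW z hz _ (.inl hx), hW z hz _ (.inr h6), hW z hz _ (.inl hx'),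
          hW z hz _ (.inr hy')⟩

/-- A set pair spanning a complete bipartite subgraph of a bipartite graph, with both sides
nontrivial. -/
structure IsBiclique (G : SimpleGraph V) (f : V → Bool) (X Y : Set V) : Prop where
  left : ∀ x ∈ X, f x = true
  right : ∀ y ∈ Y, f y = false
  adj : ∀ x ∈ X, ∀ y ∈ Y, G.Adj x y
  left_nontrivial : X.Nontrivial
  right_nontrivial : Y.Nontrivial

theorem exists_maximal_biclique [Finite V] {X₀ Y₀ : Set V} (h₀ : IsBiclique G f X₀ Y₀) :
    ∃ X Y, IsBiclique G f X Y ∧ (∀ X' Y', IsBiclique G f X' Y' → X ⊆ X' → Y ⊆ Y' →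
      X' = X ∧ Y' = Y) := by
  obtain ⟨⟨X, Y⟩, hm⟩ := (Set.toFinite {P : Set V × Set V | IsBiclique G f P.1 P.2}).exists_maximal
    ⟨(X₀, Y₀), h₀⟩
  refine ⟨X, Y, hm.1, fun X' Y' h hX hY => ?_⟩
  have := hm.eq_of_le (y := (X', Y')) h ⟨hX, hY⟩
  simp only [Prod.mk.injEq] at this
  exact ⟨this.1.symm, this.2.symm⟩

/-- A four-cycle is a biclique with two vertices on each side. A maximal one does not exhaust the
graph, which is not complete bipartite, so connectedness gives an outside neighbour for
`core_of_biclique`. -/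
theorem core_of_bipartite [Finite V] (hG : TwoConn G) (hconn : ConnIn G Set.univ) (hf : Proper G f)
    (hnc : ∃ u v, f u ≠ f v ∧ ¬ G.Adj u v)
    (hdeg : ∃ w z b b', G.Adj w z ∧ G.Adj w b ∧ G.Adj w b' ∧ b ≠ z ∧ b' ≠ z ∧ b ≠ b') :
    Core G (Fin 3) := by
  by_cases hsq : ∀ x x' y y', x ≠ x' → y ≠ y' → G.Adj x y → G.Adj x y' → G.Adj x' y →
      G.Adj x' y' → False
  · obtain ⟨w, z, b, b', h1, h2, h3, h4, h5, h6⟩ := hdeg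
    exact core_of_bipartite_of_no_square hG hf hsq h1 h2 h3 h4 h5 h6
  push Not at hsq
  obtain ⟨X₀, Y₀, h₀⟩ : ∃ X₀ Y₀, IsBiclique G f X₀ Y₀ := by
    obtain ⟨x, x', y, y', h1, h2, h3, h4, h5, h6, -⟩ := hsq
    have e1 := hf _ _ h3
    have e2 := hf _ _ h4
    have e3 := hf _ _ h5
    rcases hb : f x with _ | _
    · rw [hb] at e1 e2
      have e1' : f y = true := by simpa using e1.symm
      have e2' : f y' = true := by simpa using e2.symm
      rw [e1'] at e3
      refine ⟨{y, y'}, {x, x'}, ?_, ?_, ?_, ⟨y, by simp, y', by simp, h2⟩,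
        ⟨x, by simp, x', by simp, h1⟩⟩
      · simp [e1', e2']
      · simpa [hb] using e3
      · simp [h3.symm, h4.symm, h5.symm, h6.symm]
    · rw [hb] at e1 e2
      have e1' : f y = false := by simpa using e1.symm
      have e2' : f y' = false := by simpa using e2.symm
      rw [e1'] at e3
      refine ⟨{x, x'}, {y, y'}, ?_, ?_, ?_, ⟨x, by simp, x', by simp, h1⟩,
        ⟨y, by simp, y', by simp, h2⟩⟩
      · simpa [hb] using e3
      · simp [e1', e2']
      · simp [h3, h4, h5, h6]
  obtain ⟨X, Y, hXY, hmax⟩ := exists_maximal_biclique h₀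
  obtain ⟨x₀, hx₀⟩ := hXY.left_nontrivial.nonempty
  obtain ⟨y₀, hy₀⟩ := hXY.right_nontrivial.nonempty
  have hmY : ∀ e, (∀ x ∈ X, G.Adj e x) → e ∈ Y := fun e he => by
    have := (hmax X (insert e Y) ⟨hXY.left, ?_, ?_, hXY.left_nontrivial,
      hXY.right_nontrivial.mono (Set.subset_insert ..)⟩ subset_rfl (Set.subset_insert ..)).2
    · rw [← this]; exact Set.mem_insert ..
    · rintro y (rfl | hy)
      · have := hf _ _ (he x₀ hx₀)
        simpa [hXY.left x₀ hx₀] using this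
      · exact hXY.right y hy
    · rintro x hx y (rfl | hy)
      exacts [(he x hx).symm, hXY.adj x hx y hy]
  have hmX : ∀ e, (∀ y ∈ Y, G.Adj e y) → e ∈ X := fun e he => by
    have := (hmax (insert e X) Y ⟨?_, hXY.right, ?_,
      hXY.left_nontrivial.mono (Set.subset_insert ..), hXY.right_nontrivial⟩
      (Set.subset_insert ..) subset_rfl).1
    · rw [← this]; exact Set.mem_insert ..
    · rintro y (rfl | hy)
      · have := hf _ _ (he y₀ hy₀)
        simpa [hXY.right y₀ hy₀] using this
      · exact hXY.left y hy
    · rintro x (rfl | hx) y hy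
      exacts [he y hy, hXY.adj x hx y hy]
  have hout : ∃ v, v ∉ X ∪ Y := by
    by_contra hcon
    push Not at hcon
    obtain ⟨u, v, h1, h2⟩ := hnc
    rcases hcon u with hu | hu <;> rcases hcon v with hv | hv
    · exact h1 ((hXY.left u hu).trans (hXY.left v hv).symm)
    · exact h2 (hXY.adj u hu v hv)
    · exact h2 (hXY.adj v hv u hu).symm
    · exact h1 ((hXY.right u hu).trans (hXY.right v hv).symm)
  obtain ⟨v, hv⟩ := hout
  obtain ⟨e, x, -, h2, h3, h4, -⟩ := (hconn v trivial x₀ trivial).exists_first (Z := X ∪ Y) trivial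
    hv (.inl hx₀)
  rcases h4 with h4 | h4
  · exact core_of_biclique hG hf (s := true) hXY.left hXY.right hXY.adj hXY.left_nontrivial
      hXY.right_nontrivial hmY (fun h => h2.2 (.inr h)) h4 h3
  · exact core_of_biclique hG hf (s := false) hXY.right hXY.left
      (fun x hx y hy => (hXY.adj y hy x hx).symm) hXY.right_nontrivial
      hXY.left_nontrivial hmX (fun h => h2.2 (.inl h)) h4 h3

end Bipartite

/-! ### Colourings of vertex sets and critical sets -/

section Critical

variable {V K : Type*} {G : SimpleGraph V} {X Y : Set V} {m : ℕ}

/-- `c` is a proper colouring of the subgraph induced by `X`. -/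
def ProperOn (G : SimpleGraph V) (X : Set V) (c : V → K) : Prop :=
  ∀ u ∈ X, ∀ v ∈ X, G.Adj u v → c u ≠ c v

theorem Proper.properOn {c : V → K} (hc : Proper G c) (X : Set V) : ProperOn G X c :=
  fun u _ v _ h => hc u v h

/-- The subgraph induced by `X` is `m`-colourable. -/
def ColOn (G : SimpleGraph V) (X : Set V) (m : ℕ) : Prop :=
  ∃ f : V → ℕ, (∀ x ∈ X, f x < m) ∧ ProperOn G X f

theorem ColOn.mono (h : ColOn G Y m) (hXY : X ⊆ Y) : ColOn G X m :=
  let ⟨f, h1, h2⟩ := h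
  ⟨f, fun x hx => h1 x (hXY hx), fun u hu v hv => h2 u (hXY hu) v (hXY hv)⟩

theorem ColOn.mono_right {n : ℕ} (h : ColOn G X m) (hmn : m ≤ n) : ColOn G X n :=
  let ⟨f, h1, h2⟩ := h
  ⟨f, fun x hx => (h1 x hx).trans_le hmn, h2⟩

theorem colOn_of_finset {c : V → K} {A : Finset K} (hc : ProperOn G X c) (hA : ∀ x ∈ X, c x ∈ A)
    (hm : A.card ≤ m) : ColOn G X m := by
  refine ⟨fun z => if h : c z ∈ A then A.equivFin ⟨c z, h⟩ else 0, fun x hx => ?_,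
    fun u hu v hv huv => ?_⟩
  · simp only [hA x hx, dif_pos]
    exact (Fin.is_lt _).trans_le hm
  · simp only [hA u hu, hA v hv, dif_pos, ne_eq, Fin.val_inj, EmbeddingLike.apply_eq_iff_eq,
      Subtype.mk.injEq]
    exact hc u hu v hv huv

theorem ColOn.exists_map [Nonempty K] (h : ColOn G X m) {A : Finset K} (hm : m ≤ A.card) :
    ∃ c : V → K, (∀ x ∈ X, c x ∈ A) ∧ ProperOn G X c := by
  obtain ⟨f, h1, h2⟩ := h
  refine ⟨fun z => if h : f z < A.card then (A.equivFin.symm ⟨f z, h⟩).1 else Classical.arbitrary K,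
    fun x hx => ?_, fun u hu v hv huv => ?_⟩
  · simp only [(h1 x hx).trans_le hm, dif_pos]
    exact Subtype.property _
  · simp only [(h1 u hu).trans_le hm, (h1 v hv).trans_le hm, dif_pos, ne_eq, Subtype.val_inj,
      EmbeddingLike.apply_eq_iff_eq, Fin.mk.injEq]
    exact h2 u hu v hv huv

/-- `X` is not `m`-colourable, but becomes so when any vertex is deleted. -/
def IsCritical (G : SimpleGraph V) (X : Set V) (m : ℕ) : Prop :=
  ¬ ColOn G X m ∧ ∀ x ∈ X, ColOn G (X \ {x}) m

theorem exists_critical [Finite V] (h : ¬ ColOn G Y m) : ∃ X ⊆ Y, IsCritical G X m := by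
  obtain ⟨X, hXY, hX⟩ := (Set.toFinite {X : Set V | ¬ ColOn G X m}).exists_le_minimal h
  refine ⟨X, hXY, hX.1, fun x hx => ?_⟩
  by_contra hcon
  exact (hX.2 hcon Set.sdiff_subset hx).2 rfl

/-- Colourings of two parts which meet in a cut vertex `w` can be combined. -/
theorem properOn_glue {f g : V → K} {P : Set V} {w : V} (hf : ProperOn G (X ∩ insert w P) f)
    (hg : ProperOn G (X \ P) g) (hP : ∀ a ∈ P, ∀ b ∈ X, b ≠ w → G.Adj a b → b ∈ P)
    (hw : w ∈ X) (hwP : w ∉ P) :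
    ProperOn G X fun z => if z ∈ insert w P then f z else Equiv.swap (g w) (f w) (g z) := by
  have key : ∀ a ∈ X, ∀ b ∈ X, G.Adj a b → a ∈ insert w P → b ∉ insert w P →
      f a ≠ Equiv.swap (g w) (f w) (g b) := by
    rintro a ha b hb hab (rfl | haP) hbP
    · have : g a ≠ g b := hg a ⟨ha, hwP⟩ b ⟨hb, fun h => hbP (.inr h)⟩ hab
      intro heq
      exact this ((Equiv.swap (g a) (f a)).injective ((Equiv.swap_apply_left _ _).trans heq))
    · exact absurd (hP a haP b hb (fun h => hbP (.inl h)) hab) fun h => hbP (.inr h)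
  intro a ha b hb hab
  by_cases h1 : a ∈ insert w P <;> by_cases h2 : b ∈ insert w P <;>
    simp only [h1, h2, if_true, if_false]
  · exact hf a ⟨ha, h1⟩ b ⟨hb, h2⟩ hab
  · exact key a ha b hb hab h1 h2
  · exact (key b hb a ha hab.symm h2 h1).symm
  · exact fun h => hg a ⟨ha, fun h => h1 (.inr h)⟩ b ⟨hb, fun h => h2 (.inr h)⟩ hab
      ((Equiv.injective _) h)

/-- If `x` separated `u` from `v`, the part around `u` together with `x` would miss `v`, and the
rest would miss `u`. Criticality colours both parts, and `properOn_glue` combines the colourings at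
`x`. -/
theorem IsCritical.connIn (h : IsCritical G X m) {x : V} (hx : x ∈ X) : ConnIn G (X \ {x}) := by
  intro u hu v hv
  by_contra hcon
  obtain ⟨f, hf1, hf2⟩ := h.2 v hv.1
  obtain ⟨g, hg1, hg2⟩ := h.2 u hu.1
  set P := compIn G (X \ {x}) u with hP
  have hvP : v ∉ P := fun h => hcon h.2
  have huP : u ∈ P := mem_compIn_self hu
  have hxP : x ∉ P := fun h => h.1.2 rfl
  have hxv : x ≠ v := fun h => hv.2 h.symm
  have hxu : x ≠ u := fun h => hu.2 h.symm
  have hsub : X ∩ insert x P ⊆ X \ {v} := by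
    rintro z ⟨hz, rfl | hz'⟩
    exacts [⟨hz, hxv⟩, ⟨hz, fun h => hvP (h ▸ hz')⟩]
  have hsub' : X \ P ⊆ X \ {u} := fun z hz => ⟨hz.1, fun h => hz.2 (h ▸ huP)⟩
  refine h.1 ⟨_, ?_, properOn_glue (f := f) (g := g) (P := P) (w := x)
    (fun a ha b hb => hf2 a (hsub ha) b (hsub hb))
    (fun a ha b hb => hg2 a (hsub' ha) b (hsub' hb)) ?_ hx hxP⟩
  · intro z hz
    have hfx := hf1 x ⟨hx, hxv⟩
    have hgx := hg1 x ⟨hx, hxu⟩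
    by_cases hz' : z ∈ insert x P
    · simp only [hz', if_true]
      exact hf1 z (hsub ⟨hz, hz'⟩)
    · simp only [hz', if_false, Equiv.swap_apply_def]
      have := hg1 z (hsub' ⟨hz, fun h => hz' (.inr h)⟩)
      split_ifs <;> assumption
  · exact fun a ha b hb hbx hab => compIn_closed ha hab ⟨hb, hbx⟩

/-- Exchanging two colours on a union of Kempe components. -/
theorem Proper.kempe {c : V → K} (hc : Proper G c) {α β : K} {W : Set V}
    (hW : ∀ u ∈ W, ∀ v, G.Adj u v → (c u = α ∨ c u = β) → (c v = α ∨ c v = β) → v ∈ W) :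
    Proper G fun z => if z ∈ W then Equiv.swap α β (c z) else c z := by
  have key : ∀ u v, G.Adj u v → u ∈ W → v ∉ W → Equiv.swap α β (c u) ≠ c v := by
    intro u v huv hu hv
    have hne := hc u v huv
    by_cases h : c v = α ∨ c v = β
    · have h' : ¬ (c u = α ∨ c u = β) := fun h' => hv (hW u hu v huv h' h)
      push Not at h'
      rwa [Equiv.swap_apply_of_ne_of_ne h'.1 h'.2]
    · push Not at h
      intro heq
      have := congrArg (Equiv.swap α β) heq
      rw [Equiv.swap_apply_self, Equiv.swap_apply_of_ne_of_ne h.1 h.2] at this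
      exact hne this
  intro u v huv
  by_cases hu : u ∈ W <;> by_cases hv : v ∈ W <;> simp only [hu, hv, if_true, if_false]
  · exact fun h => hc u v huv (Equiv.injective _ h)
  · exact key u v huv hu hv
  · exact (key v u huv.symm hv hu).symm
  · exact hc u v huv

end Critical

/-! ### Three colours -/

section ThreeColors

variable {V K : Type*} {G : SimpleGraph V} {X : Set V} {c : V → K} {α β γ : K} {p : V}

/-- The vertices with one of two given colours. -/
def bicolor (c : V → K) (α β : K) : Set V := {z | c z = α ∨ c z = β}

theorem Proper.kempe_comp (hc : Proper G c) (α β : K) (x : V) :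
    Proper G fun z => if z ∈ compIn G (bicolor c α β) x then Equiv.swap α β (c z) else c z :=
  hc.kempe fun _ hu _ huv _ hv => compIn_closed hu huv hv

/-- In a two-connected graph with a `3`-colouring that cannot be turned into one with a core, let `p` be
adjacent to both colours of a bicoloured component. Then `p` is the only neighbour with its colour of
its neighbour `k` in the component. -/
theorem eq_of_adj_of_color_eq (hG : TwoConn G) (hcore : ¬ Core G K) (hc : Proper G c)
    (hαβ : α ≠ β) (hall : ∀ v, c v = α ∨ c v = β ∨ c v = c p) {k l q : V} (hpk : G.Adj p k)
    (hpl : G.Adj p l) (hck : c k = α) (hcl : c l = β) (hkl : ReachIn G (bicolor c α β) k l)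
    (hkq : G.Adj k q) (hcq : c q = c p) : q = p := by
  by_contra hqp
  have hpα : c p ≠ α := fun h => hc _ _ hpk (h.trans hck.symm)
  have hpβ : c p ≠ β := fun h => hc _ _ hpl (h.trans hcl.symm)
  have hk : k ∈ bicolor c α β := .inl hck
  have hne : k ≠ l := fun h => hαβ (hck.symm.trans ((congrArg c h).trans hcl))
  obtain ⟨T, hTB, hkT, hlT, hT, hTk⟩ := hkl.exists_connIn hk hne
  have hTc : ∀ z ∈ T, c z = α ∨ c z = β := hTB
  have hnT : ∀ z, c z = c p → z ∉ T := fun z hz hzT =>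
    (hTc z hzT).elim (fun h => hpα (hz.symm.trans h)) fun h => hpβ (hz.symm.trans h)
  have hpT : p ∉ T := hnT p rfl
  have hqT : q ∉ insert p T := fun h => h.elim hqp (hnT q hcq)
  obtain ⟨r, b, hqr, hr, hrb, hb, hbk⟩ := hG.exists_attachment (X := insert p T) (a := k) (x := l)
    hqT (.inr hkT) (.inr hlT) hne.symm
  rcases hb with rfl | hb
  swap
  · exact hcore ⟨c, hc, hasCore_of_return hc hαβ hT hTk hTc hpT hkT hlT hpk hpl hck hcl hkq hcq hqT
      hqr hrb hb hbk⟩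
  have hrc : c r = α ∨ c r = β := by
    rcases hall r with h | h | h
    exacts [.inl h, .inr h, absurd h (hc _ _ hrb)]
  have hrT : r ∉ T := fun h => hr (.inr h)
  by_cases hW : ∃ t ∈ T, ReachIn G (bicolor c α β) r t
  · obtain ⟨t, htT, hrt⟩ := hW
    obtain ⟨r', s, h1, h2, h3, h4, -⟩ := hrt.exists_first (Z := T) hrc hrT htT
    refine hcore ⟨c, hc, hasCore_of_exit hc hT hTc hpT hkT hlT hpk hpl hck hcl h4 h3.symm h2.1 h2.2
      ?_⟩
    exact (h1.mono fun z hz => hz.2).symm.trans (.of_adj hrb hrT hpT)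
  push Not at hW
  rcases hrc with hrα | hrβ
  · have hc' := hc.kempe_comp α β r
    set c' : V → K := fun z => if z ∈ compIn G (bicolor c α β) r then Equiv.swap α β (c z) else c z
      with hc'def
    have hcT : ∀ z ∈ T, c' z = c z := fun z hz => if_neg fun h => hW z hz h.2
    have hr' : c' r = β := by
      have : r ∈ compIn G (bicolor c α β) r := mem_compIn_self (.inl hrα)
      simp [hc'def, this, hrα]
    exact hcore ⟨c', hc', hasCore_of_detour hc' hαβ hT (fun z hz => by rw [hcT z hz]; exact hTc z hz)
      hpT hkT hlT hpk hpl ((hcT k hkT).trans hck) ((hcT l hlT).trans hcl) hrb.symm hr' hr hqr.symm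
      hkq.symm⟩
  · exact hcore ⟨c, hc, hasCore_of_detour hc hαβ hT hTc hpT hkT hlT hpk hpl hck hcl hrb.symm hrβ hr
      hqr.symm hkq.symm⟩

/-- `p` is the only vertex of `X` with the third colour `γ`. -/
structure Special (G : SimpleGraph V) (X : Set V) (α β γ : K) (c : V → K) (p : V) : Prop where
  proper : Proper G c
  mem : p ∈ X
  color : c p = γ
  two : ∀ x ∈ X, x ≠ p → c x = α ∨ c x = β
  all : ∀ v, c v = α ∨ c v = β ∨ c v = γ

theorem Special.swap (h : Special G X α β γ c p) : Special G X β α γ c p :=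
  ⟨h.proper, h.mem, h.color, fun x hx hxp => (h.two x hx hxp).symm, fun v => or_left_comm.1 (h.all v)⟩

theorem Special.exists_adj (h : Special G X α β γ c p) (hX : IsCritical G X 2) :
    ∃ k ∈ X, G.Adj p k ∧ c k = α := by
  by_contra hcon
  push Not at hcon
  refine hX.1 (colOn_of_finset (c := fun z => if z = p then α else c z) (A := {α, β}) ?_ ?_
    Finset.card_le_two)
  · have key : ∀ v ∈ X, G.Adj p v → α ≠ c v := fun v hv huv h => hcon v hv huv h.symm
    intro u hu v hv huv
    by_cases h1 : u = p <;> by_cases h2 : v = p <;> simp only [h1, h2, if_true, if_false]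
    · exact absurd huv (by rw [h1, h2]; exact G.loopless.irrefl _)
    · exact key v hv (h1 ▸ huv)
    · exact (key u hu (h2 ▸ huv.symm)).symm
    · exact h.proper u v huv
  · intro x hx
    by_cases h1 : x = p
    · simp [h1]
    · simpa [h1] using h.two x hx h1

theorem Special.connIn (h : Special G X α β γ c p) (hX : IsCritical G X 2) : ConnIn G X := by
  obtain ⟨k, hk, hpk, -⟩ := h.exists_adj hX
  have := (hX.connIn h.mem).insert_adj (x := k) ⟨hk, hpk.ne'⟩ hpk
  rwa [Set.insert_sdiff_singleton, Set.insert_eq_of_mem h.mem] at this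

/-- The special vertex has only one neighbour in `X` of each colour. -/
theorem Special.adj_unique (h : Special G X α β γ c p) (hX : IsCritical G X 2)
    (hcore : ¬ Core G K) (hαβ : α ≠ β) {k k' : V} (hk : k ∈ X) (hk' : k' ∈ X) (hpk : G.Adj p k)
    (hpk' : G.Adj p k') (hck : c k = α) (hck' : c k' = α) : k = k' := by
  by_contra hkk'
  obtain ⟨l, hl, hpl, hcl⟩ := h.swap.exists_adj hX
  have hT := hX.connIn h.mem
  have hlT : l ∈ X \ {p} := ⟨hl, hpl.ne'⟩
  have key : ∀ k k', k ∈ X → k' ∈ X → G.Adj p k → G.Adj p k' → c k = α → c k' = α →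
      ¬ ReachIn G ((X \ {p}) \ {k'}) l k := by
    intro k k' hk hk' hpk hpk' hck hck' hr
    have hlk' : l ≠ k' := fun h => hαβ (hck'.symm.trans ((congrArg c h).symm.trans hcl))
    have hk'T : k' ∈ X \ {p} := ⟨hk', hpk'.ne'⟩
    obtain ⟨s, k'', h1, h2, h3, h4, -⟩ :=
      (hT l hlT k' hk'T).exists_first (Z := {k'}) hlT (by simpa using hlk') rfl
    obtain rfl : k'' = k' := h4
    have hl' : l ∈ (X \ {p}) \ {k''} := ⟨hlT, hlk'⟩
    have hsub : ∀ z ∈ compIn G ((X \ {p}) \ {k''}) l, z ∈ X ∧ z ≠ p ∧ z ≠ k'' :=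
      fun z hz => ⟨hz.1.1.1, hz.1.1.2, hz.1.2⟩
    exact hcore ⟨c, h.proper, hasCore_of_exit h.proper (T := compIn G ((X \ {p}) \ {k''}) l)
      (connIn_compIn hl') (fun z hz => h.two z (hsub z hz).1 (hsub z hz).2.1)
      (fun h => (hsub _ h).2.1 rfl) ⟨hr.mem hl', hr⟩ (mem_compIn_self hl') hpk hpl hck hcl
      (s := s) (q := k'') ⟨h2, h1⟩ h3 (.inl hck') (fun h => (hsub _ h).2.2 rfl)
      (.of_adj hpk'.symm (fun h => (hsub _ h).2.2 rfl) (fun h => (hsub _ h).2.1 rfl))⟩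
  have hlk : l ≠ k := fun h => hαβ (hck.symm.trans ((congrArg c h).symm.trans hcl))
  have hlk' : l ≠ k' := fun h => hαβ (hck'.symm.trans ((congrArg c h).symm.trans hcl))
  -- From `l` one of `k`, `k'` is met first. The component of `l` without the other one is the
  -- bicoloured set, and the other one is the exit to `p`.
  obtain ⟨r, s, h1, h2, h3, h4, h5⟩ := (hT l hlT k ⟨hk, hpk.ne'⟩).exists_first (Z := {k, k'}) hlT
    (by simp [hlk, hlk']) (by simp)
  have hr7 : r ≠ k ∧ r ≠ k' := by simpa using h2.2
  rcases h4 with rfl | rfl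
  · exact key s k' hk hk' hpk hpk' hck hck'
      ((h1.mono (W := (X \ {p}) \ {k'}) fun v hv => ⟨hv.1, fun h => hv.2 (.inr h)⟩).trans
        (.of_adj h3 ⟨h2.1, hr7.2⟩ ⟨h5, hkk'⟩))
  · exact key s k hk' hk hpk' hpk hck' hck
      ((h1.mono (W := (X \ {p}) \ {k}) fun v hv => ⟨hv.1, fun h => hv.2 (.inl h)⟩).trans
        (.of_adj h3 ⟨h2.1, hr7.1⟩ ⟨h5, Ne.symm hkk'⟩))

/-- The third colour can be moved from the special vertex to a neighbour in `X`. -/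
theorem Special.shift (h : Special G X α β γ c p) (hX : IsCritical G X 2) (hG : TwoConn G)
    (hcore : ¬ Core G K) (hαβ : α ≠ β) (hαγ : α ≠ γ) (hβγ : β ≠ γ) {k : V} (hk : k ∈ X)
    (hpk : G.Adj p k) (hck : c k = α) :
    ∃ c', Special G X α β γ c' k ∧ ∀ v, v ≠ p → c v = γ → c' v = γ := by
  have hcp := h.color
  -- `F` is the union of the Kempe components containing no `β`-coloured neighbour of `p`. After
  -- exchanging the colours on `F`, every `α`-coloured neighbour of `p` lies in a component that
  -- also has a `β`-coloured one, so `eq_of_adj_of_color_eq` applies to it. The rest of `X` lies in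
  -- a component outside `F`.
  obtain ⟨F, hF⟩ : ∃ F : Set V, ∀ z, z ∈ F ↔ z ∈ bicolor c α β ∧
    ∀ v ∈ compIn G (bicolor c α β) z, ¬ (G.Adj p v ∧ c v = β) := ⟨{z | _}, fun _ => Iff.rfl⟩
  have hc1 : Proper G fun z => if z ∈ F then Equiv.swap α β (c z) else c z := by
    refine h.proper.kempe (W := F) fun u hu v huv hcu hcv =>
      (hF v).2 ⟨hcv, fun z hz => ((hF u).1 hu).2 z ⟨hz.1, ?_⟩⟩
    exact (ReachIn.of_adj huv hcu hcv).trans hz.2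
  set c1 : V → K := fun z => if z ∈ F then Equiv.swap α β (c z) else c z with hc1def
  have hc1γ : ∀ v, c1 v = γ ↔ c v = γ := by
    intro v
    by_cases hv : v ∈ F
    · simp only [hc1def, hv, if_true]
      rcases ((hF v).1 hv).1 with h1 | h1 <;> simp [h1, hαγ, hβγ]
    · simp [hc1def, hv]
  have hc1X : ∀ x ∈ X, c1 x = c x := by
    intro x hx
    refine if_neg fun hxF => ?_
    obtain ⟨l, hl, hpl, hcl⟩ := h.swap.exists_adj hX
    have hxp : x ≠ p := by
      rintro rfl
      rcases ((hF _).1 hxF).1 with h1 | h1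
      exacts [hαγ (h1.symm.trans hcp), hβγ (h1.symm.trans hcp)]
    exact ((hF x).1 hxF).2 l ⟨.inr hcl, (hX.connIn h.mem x ⟨hx, hxp⟩ l ⟨hl, hpl.ne'⟩).mono
      fun z hz => h.two z hz.1 hz.2⟩ ⟨hpl, hcl⟩
  have hA : ∀ z q, G.Adj p z → c1 z = α → G.Adj z q → c q = γ → q = p := by
    intro z q hpz hcz hzq hcq
    have hzF : z ∉ F := by
      intro hz
      have hz' := (hF z).1 hz
      rcases hz'.1 with h1 | h1
      · simp only [hc1def, hz, if_true, h1, Equiv.swap_apply_left] at hcz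
        exact hαβ hcz.symm
      · exact hz'.2 z (mem_compIn_self hz'.1) ⟨hpz, h1⟩
    have hcz' : c z = α := by simpa [hc1def, hzF] using hcz
    obtain ⟨l, hl, hpl, hcl⟩ : ∃ l ∈ compIn G (bicolor c α β) z, G.Adj p l ∧ c l = β := by
      by_contra hcon
      push Not at hcon
      exact hzF <| (hF z).2 ⟨.inl hcz', fun v hv hv' => hcon v hv hv'.1 hv'.2⟩
    exact eq_of_adj_of_color_eq hG hcore h.proper hαβ (by rw [hcp]; exact h.all) hpz hpl hcz' hcl
      hl.2 hzq (hcq.trans hcp.symm)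
  -- By `hA`, the `α`-coloured neighbours of `p` have no other neighbour of colour `γ`, so they can
  -- exchange colours with `p`. Only one of them, `k`, lies in `X`.
  let c2 : V → K := fun z => if z = p then α else if G.Adj p z ∧ c1 z = α then γ else c1 z
  have hc2 : ∀ z, z ≠ p → ¬ (G.Adj p z ∧ c1 z = α) → c2 z = c1 z := fun z h1 h2 => by
    simp [c2, h1, h2]
  have hc2' : ∀ z, G.Adj p z → c1 z = α → c2 z = γ := fun z h1 h2 => by
    simp [c2, h1.ne', h1, h2]
  have hc2p : c2 p = α := by simp [c2]
  refine ⟨c2, ⟨?_, hk, hc2' k hpk ((hc1X k hk).trans hck), ?_, ?_⟩, ?_⟩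
  · have key1 : ∀ v, G.Adj p v → c2 p ≠ c2 v := by
      intro v hv
      rw [hc2p]
      by_cases h1 : c1 v = α
      · rw [hc2' v hv h1]; exact hαγ
      · rw [hc2 v hv.ne' fun h => h1 h.2]; exact Ne.symm h1
    have key2 : ∀ u v, G.Adj u v → v ≠ p → G.Adj p u → c1 u = α → c2 u ≠ c2 v := by
      intro u v huv hvp hpu hcu
      have hcv : c1 v ≠ α := fun h' => hc1 u v huv (hcu.trans h'.symm)
      rw [hc2' u hpu hcu, hc2 v hvp fun h => hcv h.2]
      exact fun h' => hvp (hA u v hpu hcu huv ((hc1γ v).1 h'.symm))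
    intro u v huv
    by_cases hup : u = p
    · exact hup ▸ key1 v (hup ▸ huv)
    by_cases hvp : v = p
    · exact hvp ▸ (key1 u (hvp ▸ huv.symm)).symm
    by_cases hu : G.Adj p u ∧ c1 u = α
    · exact key2 u v huv hvp hu.1 hu.2
    by_cases hv : G.Adj p v ∧ c1 v = α
    · exact (key2 v u huv.symm hup hv.1 hv.2).symm
    rw [hc2 u hup hu, hc2 v hvp hv]
    exact hc1 u v huv
  · intro x hx hxk
    by_cases hxp : x = p
    · exact .inl (hxp ▸ hc2p)
    have hx' : ¬ (G.Adj p x ∧ c1 x = α) := fun ⟨h1, h2⟩ =>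
      hxk (h.adj_unique hX hcore hαβ hx hk h1 hpk ((hc1X x hx).symm.trans h2) hck)
    rw [hc2 x hxp hx', hc1X x hx]
    exact h.two x hx hxp
  · intro v
    by_cases hvp : v = p
    · exact .inl (hvp ▸ hc2p)
    by_cases hv : G.Adj p v ∧ c1 v = α
    · exact .inr (.inr (hc2' v hv.1 hv.2))
    rw [hc2 v hvp hv]
    by_cases hvF : v ∈ F
    · simp only [hc1def, hvF, if_true]
      rcases ((hF v).1 hvF).1 with h1 | h1 <;> simp [h1]
    · simpa [hc1def, hvF] using h.all v
  · intro v hvp hcv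
    have h1 : c1 v = γ := (hc1γ v).2 hcv
    rw [hc2 v hvp fun h' => hαγ (h'.2.symm.trans h1), h1]

/-- Iterates `Special.shift` along a walk inside `X`. Each shift takes `γ` away only from the
current special vertex, so vertices outside `X` keep it. -/
theorem Special.move (h : Special G X α β γ c p) (hX : IsCritical G X 2) (hG : TwoConn G)
    (hcore : ¬ Core G K) (hαβ : α ≠ β) (hαγ : α ≠ γ) (hβγ : β ≠ γ) {u : V} (hu : u ∈ X) :
    ∃ c', Special G X α β γ c' u ∧ ∀ v, v ∉ X → c v = γ → c' v = γ := by
  have hr := h.connIn hX p h.mem u hu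
  clear hu
  induction hr with
  | refl => exact ⟨c, h, fun _ _ h => h⟩
  | @tail b k _ hbk ih =>
    obtain ⟨c', hs, hc'⟩ := ih
    have hcomp : ∀ c'' : V → K, (∀ v, v ≠ b → c' v = γ → c'' v = γ) →
        ∀ v, v ∉ X → c v = γ → c'' v = γ := fun c'' h'' v hv hcv =>
      h'' v (fun h => hv (h ▸ hbk.2.1)) (hc' v hv hcv)
    rcases hs.two k hbk.2.2 hbk.1.ne' with hk | hk
    · obtain ⟨c'', h1, h2⟩ := hs.shift hX hG hcore hαβ hαγ hβγ hbk.2.2 hbk.1 hk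
      exact ⟨c'', h1, hcomp c'' h2⟩
    · obtain ⟨c'', h1, h2⟩ := hs.swap.shift hX hG hcore hαβ.symm hβγ hαγ hbk.2.2 hbk.1 hk
      exact ⟨c'', h1.swap, hcomp c'' h2⟩

/-- If `X` is everything, move `γ` to a vertex with three neighbours: two of them share a colour,
against `Special.adj_unique`. Otherwise an outer walk joins two vertices `a ≠ b` of `X`. With `γ` at
`a`, its end `r` next to `b` must have colour `γ`, or it would be an exit. Moving `γ` to `b` leaves
`r` with `γ`, so two adjacent vertices agree. -/
theorem Special.false (h : Special G X α β γ c p) (hX : IsCritical G X 2) (hG : TwoConn G)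
    (hconn : ConnIn G Set.univ) (hcore : ¬ Core G K) (hαβ : α ≠ β) (hαγ : α ≠ γ) (hβγ : β ≠ γ)
    (hdeg : ∃ w z b b', G.Adj w z ∧ G.Adj w b ∧ G.Adj w b' ∧ b ≠ z ∧ b' ≠ z ∧ b ≠ b') : False := by
  by_cases hXu : ∀ v, v ∈ X
  · obtain ⟨w, z, b, b', h1, h2, h3, h4, h5, h6⟩ := hdeg
    obtain ⟨c', hs, -⟩ := h.move hX hG hcore hαβ hαγ hβγ (hXu w)
    have hA : ∀ u v, G.Adj w u → G.Adj w v → c' u = α → c' v = α → u = v := fun u v hu hv =>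
      hs.adj_unique hX hcore hαβ (hXu u) (hXu v) hu hv
    have hB : ∀ u v, G.Adj w u → G.Adj w v → c' u = β → c' v = β → u = v := fun u v hu hv =>
      hs.swap.adj_unique hX hcore hαβ.symm (hXu u) (hXu v) hu hv
    rcases hs.two z (hXu z) h1.ne' with e1 | e1 <;> rcases hs.two b (hXu b) h2.ne' with e2 | e2 <;>
      rcases hs.two b' (hXu b') h3.ne' with e3 | e3
    · exact h4 (hA _ _ h2 h1 e2 e1)
    · exact h4 (hA _ _ h2 h1 e2 e1)
    · exact h5 (hA _ _ h3 h1 e3 e1)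
    · exact h6 (hB _ _ h2 h3 e2 e3)
    · exact h6 (hA _ _ h2 h3 e2 e3)
    · exact h5 (hB _ _ h3 h1 e3 e1)
    · exact h4 (hB _ _ h2 h1 e2 e1)
    · exact h4 (hB _ _ h2 h1 e2 e1)
  push Not at hXu
  obtain ⟨v, hv⟩ := hXu
  obtain ⟨y, a, -, hy, hya, ha, -⟩ := (hconn v trivial p trivial).exists_first (Z := X) trivial hv
    h.mem
  have hyX : y ∉ X := hy.2
  obtain ⟨c', hs, -⟩ := h.move hX hG hcore hαβ hαγ hβγ ha
  obtain ⟨k, hk, hak, hck⟩ := hs.exists_adj hX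
  obtain ⟨l, hl, hal, hcl⟩ := hs.swap.exists_adj hX
  obtain ⟨r, b, hyr, hr, hrb, hb, hba⟩ := hG.exists_attachment hyX ha hk hak.ne'
  have hsub : Xᶜ ⊆ (X \ {a})ᶜ := fun z hz h => hz h.1
  have haT : a ∉ X \ {a} := fun h => h.2 rfl
  have hcr : c' r = γ := by
    by_contra hcr
    refine hcore ⟨c', hs.proper, hasCore_of_exit hs.proper (hX.connIn ha)
      (fun z hz => hs.two z hz.1 hz.2) haT (k := k) (l := l) ⟨hk, hak.ne'⟩ ⟨hl, hal.ne'⟩ hak hal hck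
      hcl (s := b) (q := r) ⟨hb, hba⟩ hrb.symm ?_ (hsub hr) ?_⟩
    · rcases hs.all r with h1 | h1 | h1
      exacts [.inl h1, .inr h1, absurd h1 hcr]
    · exact (hyr.mono hsub).symm.trans (.of_adj hya (hsub hyX) haT)
  obtain ⟨c'', hs'', hc''⟩ := hs.move hX hG hcore hαβ hαγ hβγ hb
  exact hs''.proper r b hrb ((hc'' r hr hcr).trans hs''.color.symm)

theorem core_of_three_colorable [Finite V] (hG : TwoConn G) (hconn : ConnIn G Set.univ)
    (h3 : ∃ c : V → Fin 3, Proper G c) (h2 : ¬ ColOn G Set.univ 2)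
    (hdeg : ∃ w z b b', G.Adj w z ∧ G.Adj w b ∧ G.Adj w b' ∧ b ≠ z ∧ b' ≠ z ∧ b ≠ b') :
    Core G (Fin 3) := by
  by_contra hcore
  -- By minimality of the class of `2`, adding one of its vertices `p` to the other two classes
  -- destroys 2-colourability. A critical set in the result contains `p` as its only vertex coloured
  -- `2`.
  obtain ⟨c, hc, hmin⟩ := (Set.toFinite {c : V → Fin 3 | Proper G c}).exists_minimalFor
    (fun c => {v | c v = 2}) _ h3
  obtain ⟨p, hp⟩ : ∃ p, c p = 2 := by
    by_contra hcon
    push Not at hcon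
    refine h2 (colOn_of_finset (A := {0, 1}) (hc.properOn _) (fun x _ => ?_) Finset.card_le_two)
    have := hcon x
    revert this
    generalize c x = i
    revert i
    decide
  have hY : ¬ ColOn G ({v | c v ≠ 2} ∪ {p}) 2 := by
    intro hcol
    obtain ⟨f, hf1, hf2⟩ := hcol.exists_map (K := Fin 3) (A := {0, 1}) (by decide)
    let c' : V → Fin 3 := fun z => if z ∈ {v | c v ≠ 2} ∪ {p} then f z else 2
    have hc'1 : ∀ z ∈ {v | c v ≠ 2} ∪ {p}, c' z = f z := fun z hz => if_pos hz
    have hc'2 : ∀ z ∉ {v | c v ≠ 2} ∪ {p}, c' z = 2 := fun z hz => if_neg hz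
    have hf2' : ∀ z ∈ {v | c v ≠ 2} ∪ {p}, f z ≠ 2 := fun z hz h => by
      have := hf1 z hz
      rw [h] at this
      revert this
      decide
    have hc' : Proper G c' := by
      intro u v huv
      by_cases hu : u ∈ {v | c v ≠ 2} ∪ {p} <;> by_cases hv : v ∈ {v | c v ≠ 2} ∪ {p}
      · rw [hc'1 u hu, hc'1 v hv]; exact hf2 u hu v hv huv
      · rw [hc'1 u hu, hc'2 v hv]; exact hf2' u hu
      · rw [hc'2 u hu, hc'1 v hv]; exact (hf2' v hv).symm
      · have h1 : c u = 2 := by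
          by_contra h; exact hu (.inl h)
        have h2 : c v = 2 := by
          by_contra h; exact hv (.inl h)
        exact absurd (h1.trans h2.symm) (hc u v huv)
    have hle : {v | c' v = 2} ≤ {v | c v = 2} := by
      intro z hz
      by_contra hcon
      have hz' : z ∈ {v | c v ≠ 2} ∪ {p} := .inl hcon
      exact hf2' z hz' ((hc'1 z hz').symm.trans hz)
    have : p ∈ {v | c' v = 2} := hmin hc' hle hp
    exact hf2' p (.inr rfl) ((hc'1 p (.inr rfl)).symm.trans this)
  obtain ⟨X, hXY, hX⟩ := exists_critical hY
  have hpX : p ∈ X := by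
    by_contra hpX
    refine hX.1 (colOn_of_finset (A := {0, 1}) (hc.properOn _) (fun x hx => ?_) Finset.card_le_two)
    have : c x ≠ 2 := by
      rcases hXY hx with h | h
      · exact h
      · exact absurd (h ▸ hx) hpX
    revert this
    generalize c x = i
    revert i
    decide
  have hs : Special G X 0 1 2 c p := by
    refine ⟨hc, hpX, hp, fun x hx hxp => ?_, fun v => ?_⟩
    · have : c x ≠ 2 := (hXY hx).resolve_right hxp
      revert this
      generalize c x = i
      revert i
      decide
    · generalize c v = i
      revert i
      decide
  exact hs.false hX hG hconn hcore (by decide) (by decide) (by decide) hdeg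

end ThreeColors

/-! ### Induced subgraphs and cut vertices -/

section Induce

universe u

variable {V K K' : Type*} {G : SimpleGraph V}

theorem Core.map (h : Core G K) {ι : K → K'} (hι : Function.Injective ι) : Core G K' := by
  obtain ⟨c, hc, d, S, x, y, hx, hy, hxy, hd, hS⟩ := h
  have key : ∀ {a b}, ReflTransGen (ArcOn G c d S) a b →
      ReflTransGen (ArcOn G (ι ∘ c) (ι ∘ d) S) a b := fun h =>
    h.lift id fun _ _ h => ⟨h.1, h.2.1, congrArg ι h.2.2⟩
  exact ⟨ι ∘ c, fun u v huv h => hc u v huv (hι h), ι ∘ d, S, x, y, hx, hy, hxy, congrArg ι hd,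
    fun s hs => ⟨key (hS s hs).1, key (hS s hs).2⟩⟩

/-- A core involves only arcs starting in `S`, so colours outside `U` are irrelevant. -/
theorem HasCore.of_induce {U : Set V} {c₀ : U → K} (h : HasCore (G.induce U) c₀) {c : V → K'}
    {ι : K → K'} (hc : ∀ u : U, c u = ι (c₀ u)) : HasCore G c := by
  obtain ⟨d, S, x, y, hx, hy, hxy, hd, hS⟩ := h
  let d' : V → K' := fun z => if h : z ∈ U then ι (d ⟨z, h⟩) else c z
  have hd' : ∀ u : U, d' u = ι (d u) := fun u => by simp [d']
  have key : ∀ {a b}, ReflTransGen (ArcOn (G.induce U) c₀ d S) a b →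
      ReflTransGen (ArcOn G c d' (Subtype.val '' S)) a b := fun h =>
    h.lift _ fun a b h => ⟨⟨a, h.1, rfl⟩, h.2.1, by rw [hc, hd', h.2.2]⟩
  refine ⟨d', Subtype.val '' S, x, y, ⟨x, hx, rfl⟩, ⟨y, hy, rfl⟩, hxy, by rw [hd', hd', hd], ?_⟩
  rintro _ ⟨s, hs, rfl⟩
  exact ⟨key (hS s hs).1, key (hS s hs).2⟩

theorem ReachIn.induce {U W : Set V} {x y : V} (h : ReachIn G W x y) (hWU : W ⊆ U) (hx : x ∈ U)
    (hy : y ∈ U) : ReachIn (G.induce U) (Subtype.val ⁻¹' W) ⟨x, hx⟩ ⟨y, hy⟩ := by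
  induction h with
  | refl => exact .refl ..
  | tail _ hbc ih =>
    exact (ih (hWU hbc.2.1)).trans (.of_adj (U := Subtype.val ⁻¹' W) hbc.1 hbc.2.1 hbc.2.2)

theorem Proper.induce {c : V → K} (hc : Proper G c) (U : Set V) :
    Proper (G.induce U) fun u : U => c u := fun u v h => hc u v h

theorem colOn_induce {U X : Set V} {m : ℕ} (hXU : X ⊆ U)
    (h : ColOn (G.induce U) (Subtype.val ⁻¹' X) m) : ColOn G X m := by
  obtain ⟨f, h1, h2⟩ := h
  refine ⟨fun z => if h : z ∈ U then f ⟨z, h⟩ else 0, fun x hx => ?_, fun u hu v hv huv => ?_⟩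
  · simpa [hXU hx] using h1 ⟨x, hXU hx⟩ hx
  · simpa [hXU hu, hXU hv] using h2 ⟨u, hXU hu⟩ hu ⟨v, hXU hv⟩ hv huv

/-- `P` is a union of components of `G` with the vertex `w` deleted. -/
def IsSide (G : SimpleGraph V) (w : V) (P : Set V) : Prop :=
  w ∉ P ∧ ∀ a ∈ P, ∀ b, b ≠ w → G.Adj a b → b ∈ P

theorem isSide_compIn (w x : V) : IsSide G w (compIn G {w}ᶜ x) :=
  ⟨fun h => h.1 rfl, fun _ ha _ hb hab => compIn_closed ha hab hb⟩

/-- Outside the side use `g` with two colours exchanged so as to agree at `w`. -/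
theorem Core.of_side {w : V} {P : Set V} (hP : IsSide G w P)
    (h : Core (G.induce (insert w P)) K) {g : V → K} (hg : Proper G g) : Core G K := by
  obtain ⟨c₀, hc₀, hcore⟩ := h
  let f : V → K := fun z => if h : z ∈ insert w P then c₀ ⟨z, h⟩ else g z
  have hglue := properOn_glue (G := G) (X := Set.univ) (f := f) (g := g) (P := P) (w := w) ?_
    (hg.properOn _) (fun a ha b _ hb hab => hP.2 a ha b hb hab) trivial hP.1
  · refine ⟨_, fun u v huv => hglue u trivial v trivial huv, hcore.of_induce (ι := id) ?_⟩
    intro u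
    have hu : (u : V) ∈ insert w P := u.2
    simp only [hu, if_true, f, dif_pos, id]
  · rintro a ⟨-, ha⟩ b ⟨-, hb⟩ hab
    simp only [f, ha, hb, dif_pos]
    exact hc₀ ⟨a, ha⟩ ⟨b, hb⟩ hab

/-- Walks can be retracted into one side of a cut vertex. -/
theorem ReachIn.retract {w w' x y : V} {P : Set V} (hP : IsSide G w P)
    (h : ReachIn G {w'}ᶜ x y) (hx : x ∈ insert w P) (hy : y ∈ insert w P) :
    ReachIn G (insert w P \ {w'}) x y := by
  -- An excursion out of the side begins and ends at `w`, so it can be collapsed to `w`.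
  let r : V → V := fun z => if z ∈ insert w P then z else w
  have hr : ∀ z ∈ insert w P, r z = z := fun z hz => if_pos hz
  have hr' : ∀ z ∉ insert w P, r z = w := fun z hz => if_neg hz
  have hout : ∀ a ∈ insert w P, ∀ b ∉ insert w P, G.Adj a b → a = w := by
    rintro a (ha | ha) b hb hab
    · exact ha
    · exact absurd (.inr (hP.2 a ha b (fun h => hb (.inl h)) hab)) hb
  suffices hs : ReachIn G (insert w P \ {w'}) (r x) (r y) by rwa [hr x hx, hr y hy] at hs
  clear hx hy
  induction h with
  | refl => exact .refl ..
  | @tail b c _ hbc ih =>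
    refine ih.trans ?_
    by_cases h1 : b ∈ insert w P <;> by_cases h2 : c ∈ insert w P
    · rw [hr b h1, hr c h2]
      exact .of_adj hbc.1 ⟨h1, hbc.2.1⟩ ⟨h2, hbc.2.2⟩
    · rw [hr b h1, hr' c h2, hout b h1 c h2 hbc.1]
      exact .refl ..
    · rw [hr' b h1, hr c h2, hout c h2 b h1 hbc.1.symm]
      exact .refl ..
    · rw [hr' b h1, hr' c h2]
      exact .refl ..

/-- A set of vertices which no single vertex separates and which induces neither a bipartite graph nor
a cycle nor a complete graph. -/
structure Dense (G : SimpleGraph V) (X : Set V) : Prop where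
  insep : ∀ w, ∀ x ∈ X, ∀ y ∈ X, x ≠ w → y ≠ w → ReachIn G {w}ᶜ x y
  nonbip : ¬ ColOn G X 2
  deg : ∃ a ∈ X, ∃ z ∈ X, ∃ b ∈ X, ∃ b' ∈ X,
    G.Adj a z ∧ G.Adj a b ∧ G.Adj a b' ∧ b ≠ z ∧ b' ≠ z ∧ b ≠ b'
  nonadj : ∃ x ∈ X, ∃ y ∈ X, x ≠ y ∧ ¬ G.Adj x y

theorem Dense.induce {X U : Set V} (h : Dense G X) (hXU : X ⊆ U)
    (hins : ∀ w ∈ U, ∀ x ∈ X, ∀ y ∈ X, x ≠ w → y ≠ w → ReachIn G (U \ {w}) x y) :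
    Dense (G.induce U) (Subtype.val ⁻¹' X) := by
  refine ⟨?_, fun h' => h.nonbip (colOn_induce hXU h'), ?_, ?_⟩
  · rintro ⟨w, hw⟩ ⟨x, hx⟩ hxX ⟨y, hy⟩ hyX hxw hyw
    refine ((hins w hw x hxX y hyX (fun h => hxw (Subtype.ext h))
      (fun h => hyw (Subtype.ext h))).induce Set.sdiff_subset hx hy).mono ?_
    intro z hz hzw
    have hzw' : z = ⟨w, hw⟩ := hzw
    exact hz.2 (congrArg Subtype.val hzw')
  · obtain ⟨a, ha, z, hz, b, hb, b', hb', h1, h2, h3, h4, h5, h6⟩ := h.deg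
    exact ⟨⟨a, hXU ha⟩, ha, ⟨z, hXU hz⟩, hz, ⟨b, hXU hb⟩, hb, ⟨b', hXU hb'⟩, hb', h1, h2, h3,
      fun h => h4 (congrArg Subtype.val h), fun h => h5 (congrArg Subtype.val h),
      fun h => h6 (congrArg Subtype.val h)⟩
  · obtain ⟨x, hx, y, hy, h1, h2⟩ := h.nonadj
    exact ⟨⟨x, hXU hx⟩, hx, ⟨y, hXU hy⟩, hy, fun h => h1 (congrArg Subtype.val h), h2⟩

/-- One of three distinct vertices differs from both given ends and can be deleted. On two vertices
`TwoConn` does not imply connectedness. -/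
theorem TwoConn.connIn_univ (hG : TwoConn G) {a b b' : V} (hab : a ≠ b) (hab' : a ≠ b')
    (hbb' : b ≠ b') : ConnIn G Set.univ := by
  intro x _ y _
  obtain ⟨w, hx, hy⟩ : ∃ w, x ≠ w ∧ y ≠ w := by
    by_contra! hcon
    by_cases h1 : x = a
    · have h2 := hcon b (h1 ▸ hab)
      have h3 := hcon b' (h1 ▸ hab')
      exact hbb' (h2.symm.trans h3)
    · have h1' := hcon a h1
      by_cases h2 : x = b
      · exact hab' (h1'.symm.trans (hcon b' (h2 ▸ hbb')))
      · exact hab (h1'.symm.trans (hcon b h2))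
  exact (hG w x hx y hy).mono (Set.subset_univ _)

theorem Dense.connIn_univ {X : Set V} (h : Dense G X) (hG : TwoConn G) : ConnIn G Set.univ := by
  obtain ⟨a, -, z, -, b, -, b', -, h1, h2, h3, h4, h5, h6⟩ := h.deg
  exact hG.connIn_univ h1.ne h2.ne h4.symm

/-- Graphs which are `t`-colourable and have a dense set have a `t`-colouring with a core. -/
def DenseCore (t : ℕ) : Prop :=
  ∀ (V : Type u) [Finite V] (G : SimpleGraph V) (X : Set V), Dense G X →
    (∃ c : V → Fin t, Proper G c) → Core G (Fin t)

/-- Induction on the number of vertices. A cut vertex does not separate the dense set, which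
therefore lies in one side, and a core of that side extends by `Core.of_side`. -/
theorem denseCore_of_twoConn {t : ℕ} (h : ∀ (V : Type u) [Finite V] (G : SimpleGraph V) (X : Set V),
    TwoConn G → Dense G X → (∃ c : V → Fin t, Proper G c) → Core G (Fin t)) : DenseCore.{u} t := by
  have main : ∀ n, ∀ (V : Type u) [Finite V] (G : SimpleGraph V) (X : Set V), Nat.card V = n →
      Dense G X → (∃ c : V → Fin t, Proper G c) → Core G (Fin t) := by
    intro n
    induction n using Nat.strong_induction_on with
    | _ n ih =>
      intro V _ G X hn hX hcol
      by_cases hG : TwoConn G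
      · exact h V G X hG hX hcol
      simp only [TwoConn, not_forall] at hG
      obtain ⟨w, hw⟩ := hG
      obtain ⟨x, hx, hxw⟩ : ∃ x ∈ X, x ≠ w := by
        obtain ⟨x, hx, y, hy, h1, -⟩ := hX.nonadj
        by_cases h2 : x = w
        · exact ⟨y, hy, fun h3 => h1 (h2.trans h3.symm)⟩
        · exact ⟨x, hx, h2⟩
      set P := compIn G {w}ᶜ x with hPdef
      have hP : IsSide G w P := isSide_compIn w x
      have hXP : X ⊆ insert w P := by
        intro z hz
        by_cases hzw : z = w
        · exact .inl hzw
        · exact .inr ⟨hzw, hX.insep w x hx z hz hxw hzw⟩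
      obtain ⟨v, hv⟩ : ∃ v, v ∉ insert w P := by
        by_contra! hcon
        have hPc : P = {w}ᶜ := by
          ext z
          refine ⟨fun hz => hz.1, fun hz => (hcon z).resolve_left hz⟩
        refine hw ?_
        rw [← hPc]
        exact connIn_compIn hxw
      have hlt : Nat.card (insert w P : Set V) < n := by
        rw [← hn, Nat.card_coe_set_eq, ← Set.ncard_univ]
        exact Set.ncard_lt_ncard ⟨Set.subset_univ _, fun h => hv (h trivial)⟩
      obtain ⟨c, hc⟩ := hcol
      refine Core.of_side hP (ih _ hlt _ (G.induce (insert w P)) _ rfl (hX.induce hXP ?_)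
        ⟨_, hc.induce _⟩) hc
      intro w' hw' a ha b hb haw hbw
      exact (hX.insep w' a ha b hb haw hbw).retract hP (hXP ha) (hXP hb)
  exact fun V _ G X => main _ V G X rfl

theorem denseCore_three : DenseCore.{u} 3 :=
  denseCore_of_twoConn fun V _ G X hG hX h3 => by
    refine core_of_three_colorable hG (hX.connIn_univ hG) h3
      (fun h => hX.nonbip (h.mono (Set.subset_univ _))) ?_
    obtain ⟨a, -, z, -, b, -, b', -, h⟩ := hX.deg
    exact ⟨a, z, b, b', h⟩

end Induce

/-! ### Four and more colours -/

section ManyColors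

universe u

variable {V K : Type*} {G : SimpleGraph V} {X : Set V} {m : ℕ}

/-- If `a` saw no vertex of colour `κ`, it could take `κ`, and `X` would be `m`-colourable. -/
theorem IsCritical.exists_adj (hX : IsCritical G X m) {a : V} {f : V → K} {A : Finset K}
    (hA : A.card ≤ m) (hf : ProperOn G (X \ {a}) f) (hfA : ∀ x ∈ X \ {a}, f x ∈ A) {κ : K}
    (hκ : κ ∈ A) : ∃ b ∈ X, G.Adj a b ∧ f b = κ := by
  by_contra hcon
  push Not at hcon
  refine hX.1 (colOn_of_finset (c := fun z => if z = a then κ else f z) (A := A) ?_ ?_ hA)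
  · have key : ∀ v ∈ X, G.Adj a v → κ ≠ f v := fun v hv huv h => hcon v hv huv h.symm
    intro u hu v hv huv
    by_cases h1 : u = a <;> by_cases h2 : v = a <;> simp only [h1, h2, if_true, if_false]
    · exact absurd huv (by rw [h1, h2]; exact G.loopless.irrefl _)
    · exact key v hv (h1 ▸ huv)
    · exact (key u hu (h2 ▸ huv.symm)).symm
    · exact hf u ⟨hu, h1⟩ v ⟨hv, h2⟩ huv
  · intro x hx
    by_cases h1 : x = a
    · simpa [h1] using hκ
    · simpa [h1] using hfA x ⟨hx, h1⟩

theorem IsCritical.exists_nbr (hX : IsCritical G X m) {a : V} (ha : a ∈ X) :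
    ∃ f : V → ℕ, ∀ i < m, ∃ b ∈ X, G.Adj a b ∧ f b = i := by
  obtain ⟨f, hf1, hf2⟩ := hX.2 a ha
  exact ⟨f, fun i hi => hX.exists_adj (A := Finset.range m) (by simp) hf2 (by simpa using hf1)
    (by simpa using hi)⟩

theorem IsCritical.exists_two_nbrs (hX : IsCritical G X m) (hm : 2 ≤ m) {a : V} (ha : a ∈ X) :
    ∃ b ∈ X, ∃ b' ∈ X, G.Adj a b ∧ G.Adj a b' ∧ b ≠ b' := by
  obtain ⟨f, hf⟩ := hX.exists_nbr ha
  obtain ⟨b, hb, hab, h1⟩ := hf 0 (by omega)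
  obtain ⟨b', hb', hab', h2⟩ := hf 1 (by omega)
  exact ⟨b, hb, b', hb', hab, hab', fun h => by rw [h] at h1; omega⟩

theorem IsCritical.connIn_self (hX : IsCritical G X m) (hm : 2 ≤ m) : ConnIn G X := by
  intro a ha
  obtain ⟨k, hk, -, -, hpk, -⟩ := hX.exists_two_nbrs hm ha
  have := (hX.connIn ha).insert_adj (x := k) ⟨hk, hpk.ne'⟩ hpk
  rw [Set.insert_sdiff_singleton, Set.insert_eq_of_mem ha] at this
  exact this a ha

/-- A critical set stays connected when any vertex is removed. -/
theorem IsCritical.reachIn (hX : IsCritical G X m) (hm : 2 ≤ m) {w x y : V} (hx : x ∈ X) (hy : y ∈ X)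
    (hxw : x ≠ w) (hyw : y ≠ w) : ReachIn G (X \ {w}) x y := by
  by_cases hw : w ∈ X
  · exact hX.connIn hw x ⟨hx, hxw⟩ y ⟨hy, hyw⟩
  · rw [Set.sdiff_singleton_eq_self hw]
    exact hX.connIn_self hm x hx y hy

theorem card_erase_two [Fintype K] [DecidableEq K] {α β : K} (h : α ≠ β) (hm : Fintype.card K = m + 2) :
    ((Finset.univ.erase α).erase β).card = m := by
  rw [Finset.card_erase_of_mem (by simp [h.symm]), Finset.card_erase_of_mem (by simp),
    Finset.card_univ, hm]
  omega

/-- A critical set can be coloured with one given vertex alone in its colour, avoiding a colour. -/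
theorem IsCritical.exists_coloring [Fintype K] (hK : Fintype.card K = m + 2)
    (hX : IsCritical G X m) {b : V} (hb : b ∈ X) {ε β : K} (hβ : β ≠ ε) :
    ∃ f : V → K, ProperOn G X f ∧ f b = β ∧ ∀ x ∈ X, f x ≠ ε ∧ (x ≠ b → f x ≠ β) := by
  have : Nonempty K := ⟨ε⟩
  obtain ⟨f, hf1, hf2⟩ := (hX.2 b hb).exists_map (A := (Finset.univ.erase ε).erase β)
    (card_erase_two hβ.symm hK).ge
  have hf1' : ∀ x ∈ X, x ≠ b → f x ≠ β ∧ f x ≠ ε := fun x hx hxb => by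
    simpa using hf1 x ⟨hx, hxb⟩
  refine ⟨fun z => if z = b then β else f z, ?_, by simp, fun x hx => ?_⟩
  · intro u hu v hv huv
    by_cases h1 : u = b <;> by_cases h2 : v = b <;> simp only [h1, h2, if_true, if_false]
    · exact absurd huv (by rw [h1, h2]; exact G.loopless.irrefl _)
    · exact (hf1' v hv h2).1.symm
    · exact (hf1' u hu h1).1
    · exact hf2 u ⟨hu, h1⟩ v ⟨hv, h2⟩ huv
  · by_cases h1 : x = b
    · simp [h1, hβ]
    · simpa [h1] using (hf1' x hx h1).symm

/-- If the pieces which hang at the vertices of `X` outside a colour class are disjoint, their colours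
can be permuted independently. -/
theorem Proper.permute_pieces {c : V → K} (hc : Proper G c) {ε : K} (hXε : ∀ x ∈ X, c x ≠ ε)
    (hdisj : ∀ x ∈ X, ∀ x' ∈ X, x ≠ x' → ∀ z, ReachIn G (insert x ({z | c z ≠ ε} \ X)) x z →
      ¬ ReachIn G (insert x' ({z | c z ≠ ε} \ X)) x' z)
    {f : V → K} (hf : ProperOn G X f) (π : V → Equiv.Perm K) (hπε : ∀ x ∈ X, π x ε = ε)
    (hπ : ∀ x ∈ X, π x (c x) = f x) :
    ∃ c' : V → K, Proper G c' ∧ ∀ x ∈ X, ∀ z,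
      ReachIn G (insert x ({z | c z ≠ ε} \ X)) x z → c' z = π x (c z) := by
  set U : Set V := {z | c z ≠ ε} with hU
  let c' : V → K := fun z => if h : ∃ x, x ∈ X ∧ ReachIn G (insert x (U \ X)) x z then
    π h.choose (c z) else c z
  have h1 : ∀ x ∈ X, ∀ z, ReachIn G (insert x (U \ X)) x z → c' z = π x (c z) := by
    intro x hx z hz
    have h : ∃ x, x ∈ X ∧ ReachIn G (insert x (U \ X)) x z := ⟨x, hx, hz⟩
    have heq : h.choose = x := by
      by_contra hne
      exact hdisj _ h.choose_spec.1 x hx hne z h.choose_spec.2 hz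
    simp only [c', h, dif_pos]
    rw [heq]
  have h2 : ∀ z, (¬ ∃ x, x ∈ X ∧ ReachIn G (insert x (U \ X)) x z) → c' z = c z :=
    fun z hz => dif_neg hz
  have hmem : ∀ x ∈ X, ∀ z, ReachIn G (insert x (U \ X)) x z → z = x ∨ z ∈ U \ X :=
    fun x _ z hz => hz.mem (Set.mem_insert ..)
  have hε : ∀ z, c z = ε → c' z = ε := by
    intro z hz
    rw [h2 z, hz]
    rintro ⟨x, hx, hr⟩
    rcases hmem x hx z hr with rfl | h
    exacts [hXε z hx hz, h.1 hz]
  have hε' : ∀ z, c z ≠ ε → c' z ≠ ε := by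
    intro z hz
    by_cases h : ∃ x, x ∈ X ∧ ReachIn G (insert x (U \ X)) x z
    · obtain ⟨x, hx, hr⟩ := h
      rw [h1 x hx z hr]
      intro heq
      exact hz ((π x).injective (heq.trans (hπε x hx).symm))
    · rwa [h2 z h]
  have hstep : ∀ u v, G.Adj u v → u ∈ U → v ∈ U → u ∉ X → c' u ≠ c' v := by
    intro u v huv hu hv huX
    have hcommon : ∀ x ∈ X, ReachIn G (insert x (U \ X)) x u → ReachIn G (insert x (U \ X)) x v →
        c' u ≠ c' v := by
      intro x hx hxu hxv h
      rw [h1 x hx u hxu, h1 x hx v hxv] at h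
      exact hc u v huv ((π x).injective h)
    by_cases hvX : v ∈ X
    · exact hcommon v hvX (.of_adj huv.symm (.inl rfl) (.inr ⟨hu, huX⟩)) (.refl ..)
    by_cases h : ∃ x, x ∈ X ∧ ReachIn G (insert x (U \ X)) x u
    · obtain ⟨x, hx, hr⟩ := h
      exact hcommon x hx hr (hr.trans (.of_adj huv (.inr ⟨hu, huX⟩) (.inr ⟨hv, hvX⟩)))
    · have h' : ¬ ∃ x, x ∈ X ∧ ReachIn G (insert x (U \ X)) x v := by
        rintro ⟨x, hx, hr⟩
        exact h ⟨x, hx, hr.trans (.of_adj huv.symm (.inr ⟨hv, hvX⟩) (.inr ⟨hu, huX⟩))⟩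
      rw [h2 u h, h2 v h']
      exact hc u v huv
  refine ⟨c', fun u v huv => ?_, h1⟩
  by_cases hu : c u = ε
  · rw [hε u hu]
    exact (hε' v fun h => hc u v huv (hu.trans h.symm)).symm
  by_cases hv : c v = ε
  · rw [hε v hv]
    exact hε' u hu
  by_cases huX : u ∈ X
  · by_cases hvX : v ∈ X
    · rw [h1 u huX u (.refl ..), h1 v hvX v (.refl ..), hπ u huX, hπ v hvX]
      exact hf u huX v hvX huv
    · exact (hstep v u huv.symm hv hu hvX).symm
  · exact hstep u v huv hu hv huX

/-- No colouring leaves a dense set after deletion of a colour class. -/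
theorem not_dense_of_color_class {t : ℕ} (ih : DenseCore.{u} t) {V : Type u} [Finite V]
    {G : SimpleGraph V} (hcore : ¬ Core G (Fin (t + 1))) {c : V → Fin (t + 1)} (hc : Proper G c)
    {ε : Fin (t + 1)} {X : Set V} (hXε : ∀ x ∈ X, c x ≠ ε) (hX : Dense G X)
    (hins : ∀ w, ∀ x ∈ X, ∀ y ∈ X, x ≠ w → y ≠ w → ReachIn G ({z | c z ≠ ε} \ {w}) x y) : False := by
  set U : Set V := {z | c z ≠ ε} with hU
  -- Deleting the class of `ε` leaves a `t`-colourable graph, so the induction hypothesis gives it a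
  -- core; giving `ε` back to the class preserves the core.
  obtain ⟨c₀, hc₀, hcore₀⟩ := ih U (G.induce U) _ (hX.induce hXε fun w _ => hins w)
    ⟨fun u => (finSuccAboveEquiv ε).symm ⟨c u, u.2⟩, fun u v huv h =>
      hc u v huv (congrArg Subtype.val ((finSuccAboveEquiv ε).symm.injective h))⟩
  let c' : V → Fin (t + 1) := fun z => if h : z ∈ U then ε.succAbove (c₀ ⟨z, h⟩) else ε
  have h1 : ∀ z (h : z ∈ U), c' z = ε.succAbove (c₀ ⟨z, h⟩) := fun z h => dif_pos h
  have h2 : ∀ z, z ∉ U → c' z = ε := fun z h => dif_neg h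
  refine hcore ⟨c', fun u v huv => ?_, hcore₀.of_induce (ι := ε.succAbove) fun u => h1 u u.2⟩
  by_cases hu : u ∈ U <;> by_cases hv : v ∈ U
  · rw [h1 u hu, h1 v hv]
    exact fun h => hc₀ ⟨u, hu⟩ ⟨v, hv⟩ huv (Fin.succAbove_right_injective h)
  · rw [h1 u hu, h2 v hv]
    exact Fin.succAbove_ne _ _
  · rw [h2 u hu, h1 v hv]
    exact (Fin.succAbove_ne _ _).symm
  · have e1 : c u = ε := not_not.1 hu
    have e2 : c v = ε := not_not.1 hv
    exact absurd (e1.trans e2.symm) (hc u v huv)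

theorem connIn_pair {a b : V} (h : G.Adj a b) : ConnIn G {a, b} := by
  have hb : ConnIn G {b} := by
    rintro x rfl y rfl
    exact .refl ..
  exact hb.insert_adj rfl h

/-- If a critical set `X` misses the colour `ε`, all its outer neighbours have the colour `ε`. -/
theorem color_outer_nbr (ih : DenseCore.{u} (m + 1)) (hm : 2 ≤ m) {V : Type u} [Finite V]
    {G : SimpleGraph V} (hG : TwoConn G) (hcore : ¬ Core G (Fin (m + 2))) {X : Set V}
    (hX : IsCritical G X m) {c : V → Fin (m + 2)} (hc : Proper G c) {ε : Fin (m + 2)}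
    (hXε : ∀ x ∈ X, c x ≠ ε) {y a : V} (hy : y ∉ X) (ha : a ∈ X) (hya : G.Adj y a) : c y = ε := by
  by_contra hcy
  have hbip : ¬ ColOn G X 2 := fun h => hX.1 (h.mono_right hm)
  have hXU : X ⊆ {z | c z ≠ ε} := hXε
  have hXX : ∀ w x y, x ∈ X → y ∈ X → x ≠ w → y ≠ w → ReachIn G ({z | c z ≠ ε} \ {w}) x y :=
    fun w x y hx hy hxw hyw => (hX.reachIn hm hx hy hxw hyw).mono
      (Set.sdiff_subset_sdiff_left hXU)
  -- Otherwise `X` together with `y` would be dense in the graph without the class of `ε`. In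
  -- particular, `y` is not adjacent to all of `X`, since then `X` would avoid two colours and be
  -- `m`-colourable.
  have hstar : ∀ a ∈ X, ∀ y ∉ X, c y ≠ ε → G.Adj y a → ∀ b ∈ X, b ≠ a →
      ¬ ReachIn G ({z | c z ≠ ε} \ {a}) y b := by
    intro a ha y hy hcy hya b hb hba hr
    have hrep : ∀ w, ∀ u ∈ insert y X, u ≠ w →
        ∃ x ∈ X, x ≠ w ∧ ReachIn G ({z | c z ≠ ε} \ {w}) u x := by
      rintro w u (rfl | hu) huw
      · by_cases hwa : w = a
        · exact ⟨b, hb, hwa ▸ hba, hwa ▸ hr⟩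
        · exact ⟨a, ha, Ne.symm hwa, .of_adj hya ⟨hcy, huw⟩ ⟨hXε a ha, Ne.symm hwa⟩⟩
      · exact ⟨u, hu, huw, .refl ..⟩
    have hins : ∀ w, ∀ u ∈ insert y X, ∀ v ∈ insert y X, u ≠ w → v ≠ w →
        ReachIn G ({z | c z ≠ ε} \ {w}) u v := by
      intro w u hu v hv huw hvw
      obtain ⟨x, hx, hxw, hux⟩ := hrep w u hu huw
      obtain ⟨x', hx', hxw', hvx⟩ := hrep w v hv hvw
      exact (hux.trans (hXX w x x' hx hx' hxw hxw')).trans hvx.symm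
    refine not_dense_of_color_class ih hcore hc (ε := ε) (X := insert y X) ?_ ⟨?_, ?_, ?_, ?_⟩ hins
    · rintro x (rfl | hx)
      exacts [hcy, hXε x hx]
    · exact fun w u hu v hv huw hvw => (hins w u hu v hv huw hvw).mono fun z hz => hz.2
    · exact fun h => hbip (h.mono (Set.subset_insert ..))
    · obtain ⟨b, hb, b', hb', h1, h2, h3⟩ := hX.exists_two_nbrs hm ha
      exact ⟨a, .inr ha, y, .inl rfl, b, .inr hb, b', .inr hb', hya.symm, h1, h2,
        fun h => hy (h ▸ hb), fun h => hy (h ▸ hb'), h3⟩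
    · obtain ⟨x, hx, hxy⟩ : ∃ x ∈ X, ¬ G.Adj y x := by
        by_contra! hcon
        refine hX.1 (colOn_of_finset (A := (Finset.univ.erase ε).erase (c y)) (hc.properOn X)
          (fun x hx => ?_) (card_erase_two (m := m) (Ne.symm hcy) (by simp)).le)
        simpa using ⟨(hc _ _ (hcon x hx)).symm, hXε x hx⟩
      exact ⟨y, .inl rfl, x, .inr hx, fun h => hy (h ▸ hx), hxy⟩
  have hclique : 3 ≤ m → ∀ x ∈ X, ∀ x' ∈ X, x ≠ x' → G.Adj x x' := by
    intro hm3
    by_contra! hcon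
    obtain ⟨x, hx, x', hx', h1, h2⟩ := hcon
    refine not_dense_of_color_class ih hcore hc hXε ⟨?_, hbip, ?_, ⟨x, hx, x', hx', h1, h2⟩⟩
      (fun w x hx y hy => hXX w x y hx hy)
    · exact fun w u hu v hv huw hvw => (hXX w u v hu hv huw hvw).mono fun z hz => hz.2
    · obtain ⟨f, hf⟩ := hX.exists_nbr ha
      obtain ⟨b0, hb0, hab0, h0⟩ := hf 0 (by omega)
      obtain ⟨b1, hb1, hab1, h1⟩ := hf 1 (by omega)
      obtain ⟨b2, hb2, hab2, h2⟩ := hf 2 (by omega)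
      exact ⟨a, ha, b0, hb0, b1, hb1, b2, hb2, hab0, hab1, hab2, fun h => by rw [h] at h1; omega,
        fun h => by rw [h] at h2; omega, fun h => by rw [h] at h1; omega⟩
  -- By `hstar`, the pieces hanging at distinct vertices of `X` off the class of `ε` are disjoint,
  -- so their colours can be permuted independently.
  have hdisj : ∀ x ∈ X, ∀ x' ∈ X, x ≠ x' → ∀ z, ReachIn G (insert x ({z | c z ≠ ε} \ X)) x z →
      ¬ ReachIn G (insert x' ({z | c z ≠ ε} \ X)) x' z := by
    intro x hx x' hx' hxx' z hz hz'
    have hzx : x ≠ z := by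
      rintro rfl
      rcases hz'.mem (Set.mem_insert ..) with h | h
      exacts [hxx' h, h.2 hx]
    obtain ⟨q, hq, hqx, hxq, hr⟩ := hz.exists_last_exit (Set.mem_insert ..) hzx
    have hq' := hq.resolve_left hqx
    refine hstar x hx q hq'.2 hq'.1 hxq.symm x' hx' hxx'.symm (ReachIn.trans (y := z) ?_ ?_)
    · refine hr.mono ?_
      rintro v ⟨rfl | hv, hvx⟩
      exacts [absurd rfl hvx, ⟨hv.1, hvx⟩]
    · refine hz'.symm.mono ?_
      rintro v (rfl | hv)
      exacts [⟨hXε v hx', hxx'.symm⟩, ⟨hv.1, fun h => hv.2 (h ▸ hx)⟩]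
  obtain ⟨b₁, hb₁, -, -, hab₁, -⟩ := hX.exists_two_nbrs hm ha
  obtain ⟨r, b, hyr, hr, hrb, hb, hba⟩ := hG.exists_attachment hy ha hb₁ hab₁.ne'
  obtain ⟨γ, hγ⟩ : ∃ γ, γ ≠ ε := exists_ne ε
  obtain ⟨f, hf, hfb, hfX⟩ := hX.exists_coloring (K := Fin (m + 2)) (by simp) hb hγ
  set A : Finset (Fin (m + 2)) := (Finset.univ.erase ε).erase γ with hA
  have hAcard : A.card = m := card_erase_two (m := m) hγ.symm (by simp)
  have hfA : ∀ x ∈ X \ {b}, f x ∈ A := fun x hx => by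
    simpa [hA] using ⟨(hfX x hx.1).2 hx.2, (hfX x hx.1).1⟩
  have hfbA : ∀ κ ∈ A, ∃ k ∈ X, G.Adj b k ∧ f k = κ := fun κ hκ =>
    hX.exists_adj hAcard.le (fun u hu v hv => hf u hu.1 v hv.1) hfA hκ
  have haA : f a ∈ A := hfA a ⟨ha, hba.symm⟩
  obtain ⟨κ, hκ, hκa⟩ := Finset.exists_mem_ne (s := A) (by omega) (f a)
  have hκε : κ ≠ ε := by
    simp only [hA, Finset.mem_erase] at hκ
    exact hκ.2.1
  obtain ⟨k, hk, hbk, hfk⟩ := hfbA (f a) haA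
  obtain ⟨l, hl, hbl, hfl⟩ := hfbA κ hκ
  let σ : V → Equiv.Perm (Fin (m + 2)) := fun x => Equiv.swap (c x) (f x)
  have hσε : ∀ x ∈ X, σ x ε = ε := fun x hx =>
    Equiv.swap_apply_of_ne_of_ne (hXε x hx).symm (hfX x hx).1.symm
  -- The permutations `σ x` realise `f` on `X`. At `a` a further transposition gives `y` the colour
  -- `κ`, so that `y` becomes an exit from `a` towards `b`.
  have hσx : ∀ x, σ x (c x) = f x := fun x => Equiv.swap_apply_left _ _
  have hσy : σ a (c y) ≠ f a := fun h => hc y a hya ((σ a).injective (h.trans (hσx a).symm))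
  have hσy' : σ a (c y) ≠ ε := fun h => hcy ((σ a).injective (h.trans (hσε a ha).symm))
  obtain ⟨c', hc', hval⟩ := hc.permute_pieces hXε hdisj hf
    (fun x => if x = a then Equiv.swap (σ a (c y)) κ * σ a else σ x)
    (fun x hx => by
      by_cases h : x = a
      · simp only [h, if_true, Equiv.Perm.mul_apply, hσε a ha]
        exact Equiv.swap_apply_of_ne_of_ne hσy'.symm hκε.symm
      · simp only [h, if_false]
        exact hσε x hx)
    (fun x hx => by
      by_cases h : x = a
      · simp only [h, if_true, Equiv.Perm.mul_apply, hσx]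
        exact Equiv.swap_apply_of_ne_of_ne hσy.symm hκa.symm
      · simp only [h, if_false]
        exact hσx x)
  have hc'X : ∀ x ∈ X, c' x = f x := fun x hx => by
    rw [hval x hx x (.refl ..)]
    by_cases h : x = a
    · simp only [h, if_true, Equiv.Perm.mul_apply, hσx]
      exact Equiv.swap_apply_of_ne_of_ne hσy.symm hκa.symm
    · simp only [h, if_false]
      exact hσx x
  have hc'y : c' y = κ := by
    rw [hval a ha y (.of_adj hya.symm (.inl rfl) (.inr ⟨hcy, hy⟩))]
    simp
  have hyb : ∀ T ⊆ X, b ∉ T → ReachIn G Tᶜ y b := fun T hT hbT =>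
    (hyr.mono (Set.compl_subset_compl.2 hT)).trans (.of_adj hrb (fun h => hr (hT h)) hbT)
  -- For `m ≥ 3` the set `X` is a clique and the edge `al` serves as bicoloured set. For `m = 2` all
  -- of `X \ {b}` is bicoloured, because `A` has just two colours.
  rcases hm.lt_or_eq with hm3 | hm2
  · have hla : l ≠ a := fun h => hκa (by rw [← hfl, h])
    have hbT : b ∉ ({a, l} : Set V) := by
      rintro (h | h)
      exacts [hba h, hbl.ne h]
    have hTX : ({a, l} : Set V) ⊆ X := by
      rintro z (rfl | rfl)
      exacts [ha, hl]
    refine hcore ⟨c', hc', hasCore_of_exit hc' (T := {a, l}) (α := f a) (β := κ) (k := a) (l := l)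
      (connIn_pair (hclique hm3 a ha l hl hla.symm)) ?_ hbT (by simp) (by simp)
      (hclique hm3 b hb a ha hba) hbl (hc'X a ha) ((hc'X l hl).trans hfl) (s := a) (q := y)
      (by simp) hya.symm (.inr hc'y) (fun h => hy (hTX h)) (hyb _ hTX hbT)⟩
    rintro z (rfl | rfl)
    exacts [.inl (hc'X z ha), .inr ((hc'X z hl).trans hfl)]
  · have hbT : b ∉ X \ {b} := fun h => h.2 rfl
    refine hcore ⟨c', hc', hasCore_of_exit hc' (T := X \ {b}) (α := f a) (β := κ) (k := k) (l := l)
      (hX.connIn hb) ?_ hbT ⟨hk, hbk.ne'⟩ ⟨hl, hbl.ne'⟩ hbk hbl ((hc'X k hk).trans hfk)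
      ((hc'X l hl).trans hfl) (s := a) (q := y) ⟨ha, hba.symm⟩ hya.symm (.inr hc'y)
      (fun h => hy h.1) (hyb _ Set.sdiff_subset hbT)⟩
    intro z hz
    have hsub : ({f a, κ} : Finset _) ⊆ A := by
      intro i hi
      simp only [Finset.mem_insert, Finset.mem_singleton] at hi
      rcases hi with rfl | rfl <;> assumption
    have heq : ({f a, κ} : Finset _) = A :=
      Finset.eq_of_subset_of_card_le hsub (by rw [hAcard, Finset.card_pair hκa.symm]; omega)
    have := hfA z hz
    rw [← heq] at this
    rw [hc'X z hz.1]
    simpa using this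

/-- If all outer neighbours of `X` have a colour which `X` misses, `X` can be recoloured. -/
theorem Proper.recolor {c f : V → K} (hc : Proper G c) {ε : K} (hf : ProperOn G X f)
    (hfε : ∀ x ∈ X, f x ≠ ε) (hout : ∀ y ∉ X, ∀ a ∈ X, G.Adj y a → c y = ε) :
    Proper G fun z => if z ∈ X then f z else c z := by
  intro u v huv
  by_cases hu : u ∈ X <;> by_cases hv : v ∈ X <;> simp only [hu, hv, if_true, if_false]
  · exact hf u hu v hv huv
  · rw [hout v hv u hu huv.symm]
    exact hfε u hu
  · rw [hout u hu v hv huv]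
    exact (hfε v hv).symm
  · exact hc u v huv

/-- An outer neighbour of a critical set is joined by a Kempe chain to every vertex which is alone in
its colour. -/
theorem reachIn_of_unique_color {c : V → K} (hc : Proper G c) {ε β : K}
    (hout : ∀ c' : V → K, Proper G c' → (∀ x ∈ X, c' x ≠ ε) → ∀ y ∉ X, ∀ a ∈ X, G.Adj y a → c' y = ε)
    (hXε : ∀ x ∈ X, c x ≠ ε) {b y a : V} (hβ : ∀ x ∈ X, x ≠ b → c x ≠ β) (hβε : β ≠ ε)
    (hy : y ∉ X) (ha : a ∈ X) (hya : G.Adj y a) : ReachIn G (bicolor c ε β) y b := by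
  by_contra hcon
  have hcy : c y = ε := hout c hc hXε y hy a ha hya
  -- Only `b` could be a vertex of `X` in the Kempe component of `y`. If it is not, exchanging
  -- colours there leaves `X` free of `ε` but takes `ε` from `y`, against `hout`.
  have hcomp : ∀ x ∈ X, x ∉ compIn G (bicolor c ε β) y := by
    rintro x hx ⟨h1 | h1, h2⟩
    · exact hXε x hx h1
    · by_cases hxb : x = b
      · exact hcon (hxb ▸ h2)
      · exact hβ x hx hxb h1
  have := hout _ (hc.kempe_comp ε β y) (fun x hx => by simpa [hcomp x hx] using hXε x hx) y hy a ha
    hya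
  have hyc : y ∈ compIn G (bicolor c ε β) y := mem_compIn_self (.inl hcy)
  simp only [hyc, if_true, hcy, Equiv.swap_apply_left] at this
  exact hβε this

/-- An outer neighbour of a critical set is adjacent to all of it. -/
theorem adj_of_outer_nbr (ih : DenseCore.{u} (m + 1)) (hm : 2 ≤ m) {V : Type u} [Finite V]
    {G : SimpleGraph V} (hG : TwoConn G) (hcore : ¬ Core G (Fin (m + 2))) {X : Set V}
    (hX : IsCritical G X m) {c : V → Fin (m + 2)} (hc : Proper G c) {ε : Fin (m + 2)}
    (hXε : ∀ x ∈ X, c x ≠ ε) {y a b : V} (hy : y ∉ X) (ha : a ∈ X) (hya : G.Adj y a)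
    (hb : b ∈ X) (hab : G.Adj a b) : G.Adj y b := by
  by_contra hyb
  have hout : ∀ c' : V → Fin (m + 2), Proper G c' → (∀ x ∈ X, c' x ≠ ε) →
      ∀ y ∉ X, ∀ a ∈ X, G.Adj y a → c' y = ε := fun c' hc' hε y hy a ha hya =>
    color_outer_nbr ih hm hG hcore hX hc' hε hy ha hya
  obtain ⟨β, hβ⟩ : ∃ β, β ≠ ε := exists_ne ε
  obtain ⟨f, hf, hfb, hfX⟩ := hX.exists_coloring (K := Fin (m + 2)) (by simp) hb hβ
  set γ := f a with hγ
  have hγβ : γ ≠ β := (hfX a ha).2 hab.ne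
  have hγε : γ ≠ ε := (hfX a ha).1
  -- Both `f` and `f'` leave `b` alone in its colour, which is `β` or `γ`. This gives two Kempe
  -- chains from `y` to `b`: an `ε`-`β` chain for `c₁`, containing the bicoloured set `T`, and an
  -- `ε`-`γ` chain for `c₂`, providing the return walk.
  let f' : V → Fin (m + 2) := fun z => Equiv.swap β γ (f z)
  have hf' : ProperOn G X f' := fun u hu v hv huv h => hf u hu v hv huv (Equiv.injective _ h)
  have hf'b : f' b = γ := by simp [f', hfb]
  have hf'a : f' a = β := by simp [f', ← hγ]
  have hswε : Equiv.swap β γ ε = ε := Equiv.swap_apply_of_ne_of_ne hβ.symm hγε.symm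
  have hf'ε : ∀ x ∈ X, f' x ≠ ε := fun x hx h =>
    (hfX x hx).1 ((Equiv.swap β γ).injective (h.trans hswε.symm))
  have hf'γ : ∀ x ∈ X, x ≠ b → f' x ≠ γ := fun x hx hxb h =>
    (hfX x hx).2 hxb ((Equiv.swap β γ).injective (h.trans (Equiv.swap_apply_left _ _).symm))
  have hp₁ := hc.recolor hf (fun x hx => (hfX x hx).1) (hout c hc hXε)
  have hp₂ := hc.recolor hf' hf'ε (hout c hc hXε)
  set c₁ : V → Fin (m + 2) := fun z => if z ∈ X then f z else c z with hc₁
  set c₂ : V → Fin (m + 2) := fun z => if z ∈ X then f' z else c z with hc₂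
  have h1X : ∀ x ∈ X, c₁ x = f x := fun x hx => if_pos hx
  have h2X : ∀ x ∈ X, c₂ x = f' x := fun x hx => if_pos hx
  have h12 : ∀ z ∉ X, c₁ z = c₂ z := fun z hz => by simp [hc₁, hc₂, hz]
  have hr₁ : ReachIn G (bicolor c₁ ε β) y b := reachIn_of_unique_color hp₁ hout
    (fun x hx => h1X x hx ▸ (hfX x hx).1) (fun x hx hxb => h1X x hx ▸ (hfX x hx).2 hxb) hβ hy ha hya
  have hr₂ : ReachIn G (bicolor c₂ ε γ) y b := reachIn_of_unique_color hp₂ hout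
    (fun x hx => h2X x hx ▸ hf'ε x hx) (fun x hx hxb => h2X x hx ▸ hf'γ x hx hxb) hγε hy ha hya
  have hyb' : y ≠ b := fun h => hy (h ▸ hb)
  have hcy : c y = ε := hout c hc hXε y hy a ha hya
  have hcy₁ : c₁ y = ε := by simp [hc₁, hy, hcy]
  have hcy₂ : c₂ y = ε := by simp [hc₂, hy, hcy]
  obtain ⟨T, hTB, hyT, hbT, hT, hTy⟩ := hr₁.exists_connIn (.inl hcy₁) hyb'
  have hTc : ∀ z ∈ T, c₁ z = ε ∨ c₁ z = β := hTB
  have hγT : ∀ z, c₁ z = γ → z ∉ T := fun z hz hzT =>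
    (hTc z hzT).elim (fun h => hγε (hz.symm.trans h)) fun h => hγβ (hz.symm.trans h)
  have hc₁a : c₁ a = γ := h1X a ha
  obtain ⟨q, hq, hqy, hyq, hqr⟩ := hr₂.exists_last_exit (.inl hcy₂) hyb'
  have hcq : c₂ q = γ := hq.resolve_left fun h => hp₂ y q hyq (hcy₂.trans h.symm)
  have hqX : q ∉ X := fun h => by
    by_cases hqb : q = b
    · exact hyb (hqb ▸ hyq)
    · exact hf'γ q h hqb (h2X q h ▸ hcq)
  have hcq₁ : c₁ q = γ := (h12 q hqX).trans hcq
  obtain ⟨r, s, h1, h2, h3, h4, h5⟩ := hqr.exists_first (Z := T) ⟨hq, hqy⟩ (hγT q hcq₁) hbT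
  -- The return walk starts at `q`, outside `X` because `b` alone has colour `γ` there under `c₂`.
  -- It avoids `a`, which has colour `β` under `c₂`.
  refine hcore ⟨c₁, hp₁, hasCore_of_return hp₁ hβ.symm hT hTy hTc (hγT a hc₁a) hyT hbT hya.symm hab
    hcy₁ ((h1X b hb).trans hfb) hyq (hcq₁.trans hc₁a.symm) ?_ (h1.mono ?_) h3 h4 h5.2⟩
  · rintro (h | h)
    exacts [hqX (h ▸ ha), hγT q hcq₁ h]
  · rintro z ⟨hz, hzT⟩ (rfl | h)
    · have hz' : c₂ z = ε ∨ c₂ z = γ := hz.1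
      rw [h2X z ha, hf'a] at hz'
      exact hz'.elim hβ hγβ.symm
    · exact hzT h

/-- A connected set which is not complete contains an induced path with three vertices. -/
theorem ReachIn.exists_induced_path {x y : V} (h : ReachIn G X x y) (hx : x ∈ X) (hxy : x ≠ y)
    (hadj : ¬ G.Adj x y) :
    ∃ b ∈ X, ∃ s ∈ X, G.Adj x b ∧ G.Adj b s ∧ x ≠ s ∧ ¬ G.Adj x s := by
  obtain ⟨b, s, -, h2, h3, h4, h5⟩ := h.exists_first (Z := {z | x ≠ z ∧ ¬ G.Adj x z}) hx
    (fun h => h.1 rfl) ⟨hxy, hadj⟩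
  have hxb : G.Adj x b := by
    by_contra hcon
    refine h2.2 ⟨?_, hcon⟩
    rintro rfl
    exact h4.2 h3
  exact ⟨b, h2.1, s, h5, hxb, h3, h4.1, h4.2⟩

/-- Unless fewer colours suffice, the vertices off the class of `ε` contain a critical set `X`.
Without a core, its outer neighbours have colour `ε` and are adjacent to all of `X`. Two of them
would give an exit, and a single one, `y`, cannot be a cut vertex, so only `X` and `y` remain. As
the graph is not complete, `X` contains an induced path `r b s`. Colouring `r` and `s` alike makes
`s` an exit from the edge `br` to `y`. -/
theorem denseCore_succ (ih : DenseCore.{u} (m + 1)) (hm : 2 ≤ m) : DenseCore.{u} (m + 2) :=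
  denseCore_of_twoConn fun V _ G Y hG hY ⟨c, hc⟩ => by
    by_cases hcol : ColOn G Set.univ (m + 1)
    · obtain ⟨f, h1, h2⟩ := hcol
      refine (ih V G Y hY ⟨fun v => ⟨f v, h1 v trivial⟩, fun u v huv h => ?_⟩).map
        (Fin.castSucc_injective (m + 1))
      exact h2 u trivial v trivial huv (congrArg Fin.val h)
    by_contra hcore
    set ε : Fin (m + 2) := 0 with hε
    obtain ⟨X, hXU, hX⟩ : ∃ X ⊆ {z | c z ≠ ε}, IsCritical G X m := by
      refine exists_critical fun ⟨f, h1, h2⟩ => hcol ⟨fun z => if c z = ε then m else f z,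
        fun z _ => ?_, fun u _ v _ huv => ?_⟩
      · by_cases hz : c z = ε
        · simp [hz]
        · simpa [hz] using (h1 z hz).trans (Nat.lt_succ_self m)
      · by_cases hu : c u = ε <;> by_cases hv : c v = ε <;> simp only [hu, hv, if_true, if_false]
        · exact absurd (hu.trans hv.symm) (hc u v huv)
        · exact (h1 v hv).ne'
        · exact (h1 u hu).ne
        · exact h2 u hu v hv huv
    have hXε : ∀ x ∈ X, c x ≠ ε := hXU
    have hconn := hX.connIn_self hm
    have hcomplete : ∀ y ∉ X, ∀ a ∈ X, G.Adj y a → ∀ b ∈ X, G.Adj y b := by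
      intro y hy a ha hya b hb
      have hr := hconn a ha b hb
      induction hr with
      | refl => exact hya
      | tail _ h hadj =>
        exact adj_of_outer_nbr ih hm hG hcore hX hc hXε hy h.2.1 (hadj h.2.1) h.2.2 h.1
    have hout : ∀ y ∉ X, ∀ a ∈ X, G.Adj y a → c y = ε := fun y hy a ha hya =>
      color_outer_nbr ih hm hG hcore hX hc hXε hy ha hya
    obtain ⟨a, ha⟩ : X.Nonempty := by
      by_contra! h
      exact hX.1 ⟨fun _ => 0, by simp [h], by simp [h, ProperOn]⟩
    obtain ⟨b, hb, -, -, hab, -⟩ := hX.exists_two_nbrs hm ha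
    have hout_unique : ∀ y ∉ X, ∀ y' ∉ X, G.Adj y a → G.Adj y' a → y = y' := by
      intro y hy y' hy' hya hya'
      by_contra hne
      have hyb := hcomplete y hy a ha hya b hb
      have hyb' := hcomplete y' hy' a ha hya' b hb
      have hT : ∀ z ∈ X, z ≠ b → z ∉ ({b, y} : Set V) := by
        rintro z hz hzb (h | rfl)
        exacts [hzb h, hy hz]
      have hy'T : y' ∉ ({b, y} : Set V) := by
        rintro (rfl | rfl)
        exacts [hy' hb, hne rfl]
      have haT := hT a ha hab.ne
      refine hcore ⟨c, hc, hasCore_of_exit hc (T := {b, y}) (α := c b) (β := ε) (k := b) (l := y)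
        (connIn_pair hyb.symm) ?_ haT (by simp) (by simp) hab hya.symm rfl (hout y hy a ha hya)
        (s := b) (q := y') (by simp) hyb'.symm (.inr (hout y' hy' a ha hya')) hy'T
        (.of_adj hya' hy'T haT)⟩
      rintro z (rfl | rfl)
      exacts [.inl rfl, .inr (hout z hy a ha hya)]
    obtain ⟨y, hy, hya⟩ : ∃ y ∉ X, G.Adj y a := by
      by_contra! hcon
      have hall : ∀ z, z ∈ X := by
        intro z
        by_contra hz
        obtain ⟨r, s, -, h2, h3, h4, -⟩ := (hY.connIn_univ hG z trivial a trivial).exists_first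
          (Z := X) trivial hz ha
        exact hcon r h2.2 (hcomplete r h2.2 s h4 h3 a ha)
      refine hcol (colOn_of_finset (A := Finset.univ.erase ε) (hc.properOn _) (fun z _ => ?_) ?_)
      · simpa using hXε z (hall z)
      · simp
    have hall : ∀ z, z ∈ X ∨ z = y := by
      intro z
      by_contra! hz
      have hay : a ≠ y := fun h => hy (h ▸ ha)
      obtain ⟨r, s, -, h2, h3, h4, -⟩ := (hG y z hz.2 a hay).exists_first
        (Z := X) hz.2 hz.1 ha
      exact h2.1 (hout_unique r h2.2 y hy (hcomplete r h2.2 s h4 h3 a ha) hya)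
    have hyX : ∀ x ∈ X, G.Adj y x := hcomplete y hy a ha hya
    obtain ⟨r, hr, b, hb, s, hs, hrb, hbs, hrs, hnadj⟩ : ∃ r ∈ X, ∃ b ∈ X, ∃ s ∈ X,
        G.Adj r b ∧ G.Adj b s ∧ r ≠ s ∧ ¬ G.Adj r s := by
      obtain ⟨u, -, v, -, huv, hadj⟩ := hY.nonadj
      have hu : u ∈ X := (hall u).resolve_right fun h => hadj <| by
        subst h
        exact hyX v ((hall v).resolve_right huv.symm)
      have hv : v ∈ X := (hall v).resolve_right fun h => hadj <| by
        subst h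
        exact (hyX u hu).symm
      exact ⟨u, hu, (hconn u hu v hv).exists_induced_path hu huv hadj⟩
    obtain ⟨κ, hκ⟩ : ∃ κ, κ ≠ ε := exists_ne ε
    obtain ⟨f, hf, hfr, hfX⟩ := hX.exists_coloring (K := Fin (m + 2)) (by simp) hr hκ
    -- Under `f` only `r` has colour `κ`, so its non-neighbour `s` may take this colour too.
    let f' : V → Fin (m + 2) := fun z => if z = s then κ else f z
    have hf's : f' s = κ := by simp [f']
    have hf'r : f' r = κ := by simp [f', hrs, hfr]
    have hf'b : f' b = f b := by simp [f', hbs.ne]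
    have hf'ε : ∀ x ∈ X, f' x ≠ ε := fun x hx => by
      by_cases h : x = s
      · simpa [f', h] using hκ
      · simpa [f', h] using (hfX x hx).1
    have hkey : ∀ v ∈ X, G.Adj s v → κ ≠ f v := fun v hv hsv h =>
      (hfX v hv).2 (fun h' => hnadj (h' ▸ hsv.symm)) h.symm
    have hf' : ProperOn G X f' := by
      intro u hu v hv huv
      by_cases h1 : u = s <;> by_cases h2 : v = s <;> simp only [f', h1, h2, if_true, if_false]
      · exact absurd huv (by rw [h1, h2]; exact G.loopless.irrefl _)
      · exact hkey v hv (h1 ▸ huv)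
      · exact (hkey u hu (h2 ▸ huv.symm)).symm
      · exact hf u hu v hv huv
    have hc' := hc.recolor hf' hf'ε hout
    have hcX : ∀ x ∈ X, (if x ∈ X then f' x else c x) = f' x := fun x hx => if_pos hx
    have hyT : y ∉ ({b, r} : Set V) := by
      rintro (rfl | rfl)
      exacts [hy hb, hy hr]
    have hsT : s ∉ ({b, r} : Set V) := by
      rintro (h | h)
      exacts [hbs.ne h.symm, hrs h.symm]
    refine hcore ⟨_, hc', hasCore_of_exit hc' (T := {b, r}) (α := f b) (β := κ) (p := y) (k := b)
      (l := r) (connIn_pair hrb.symm) ?_ hyT (by simp) (by simp) (hyX b hb) (hyX r hr)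
      ((hcX b hb).trans hf'b) ((hcX r hr).trans hf'r) (s := b) (q := s) (by simp) hbs
      (.inr ((hcX s hs).trans hf's)) hsT (.of_adj (hyX s hs).symm hsT hyT)⟩
    rintro z (rfl | rfl)
    exacts [.inl ((hcX z hb).trans hf'b), .inr ((hcX z hr).trans hf'r)]

theorem denseCore {t : ℕ} (ht : 3 ≤ t) : DenseCore.{u} t := by
  induction t, ht using Nat.le_induction with
  | base => exact denseCore_three
  | succ t ht ih =>
    obtain ⟨m, rfl⟩ : ∃ m, t = m + 1 := ⟨t - 1, by omega⟩
    exact denseCore_succ ih (by omega)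

end ManyColors

/-! ### Unique colourings from lists of size two -/

section Unique

variable {V K : Type*} {G : SimpleGraph V} {c d : V → K} {U : Set V}

/-- On `U`, the colouring `c` is the only proper one from the lists `{c v, d v}` of size two. -/
structure UniqueOn (G : SimpleGraph V) (U : Set V) (c d : V → K) : Prop where
  proper : ProperOn G U c
  ne : ∀ v ∈ U, d v ≠ c v
  unique : ∀ g : V → K, ProperOn G U g → (∀ v ∈ U, g v = c v ∨ g v = d v) → ∀ v ∈ U, g v = c v

/-- Some lists of size two with colours in `K` determine a unique colouring of `G`. -/
def Good (G : SimpleGraph V) (K : Type*) : Prop := ∃ c d : V → K, UniqueOn G Set.univ c d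

theorem UniqueOn.good_induce (h : UniqueOn G U c d) : Good (G.induce U) K := by
  refine ⟨fun u => c u, fun u => d u, fun u _ v _ huv => h.proper u u.2 v v.2 huv,
    fun u _ => h.ne u u.2, fun g hg hgc u _ => ?_⟩
  let g' : V → K := fun z => if h : z ∈ U then g ⟨z, h⟩ else c z
  have hg' : ∀ z (h : z ∈ U), g' z = g ⟨z, h⟩ := fun z h => dif_pos h
  rw [← hg' u u.2]
  refine h.unique g' (fun a ha b hb hab => ?_) (fun a ha => ?_) u u.2
  · rw [hg' a ha, hg' b hb]
    exact hg ⟨a, ha⟩ trivial ⟨b, hb⟩ trivial hab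
  · rw [hg' a ha]
    exact hgc ⟨a, ha⟩ trivial

theorem Good.uniqueOn [Nonempty K] (h : Good (G.induce U) K) : ∃ c d : V → K, UniqueOn G U c d := by
  obtain ⟨c, d, h⟩ := h
  let ext : (U → K) → V → K := fun f z => if h : z ∈ U then f ⟨z, h⟩ else Classical.arbitrary K
  have hext : ∀ f z (h : z ∈ U), ext f z = f ⟨z, h⟩ := fun f z h => dif_pos h
  refine ⟨ext c, ext d, fun a ha b hb hab => ?_, fun a ha => ?_, fun g hg hgc a ha => ?_⟩
  · rw [hext c a ha, hext c b hb]
    exact h.proper ⟨a, ha⟩ trivial ⟨b, hb⟩ trivial hab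
  · rw [hext c a ha, hext d a ha]
    exact h.ne ⟨a, ha⟩ trivial
  · rw [hext c a ha]
    refine h.unique (fun u => g u) (fun u _ v _ huv => hg u u.2 v v.2 huv) (fun u _ => ?_) ⟨a, ha⟩
      trivial
    simpa only [hext _ u u.2] using hgc u u.2

/-- If no bad edge were reached, recolouring everything reachable from `v` with its second colour
would be another proper colouring. -/
theorem UniqueOn.exists_reach (h : UniqueOn G Set.univ c d) (v : V) :
    ∃ x y, G.Adj x y ∧ d x = d y ∧ ReflTransGen (ArcOn G c d Set.univ) v x ∧
      ReflTransGen (ArcOn G c d Set.univ) v y := by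
  by_contra! hcon
  let F : Set V := {z | ReflTransGen (ArcOn G c d Set.univ) v z}
  have hv : v ∈ F := .refl
  have hF : ∀ a ∈ F, ∀ b, G.Adj a b → d a = c b → b ∈ F := fun a ha b hab h =>
    ReflTransGen.tail ha ⟨trivial, hab, h.symm⟩
  have := h.unique (fun z => if z ∈ F then d z else c z) (fun a _ b _ hab => ?_)
    (fun z _ => by by_cases hz : z ∈ F <;> simp [hz]) v trivial
  · simp only [hv, if_true] at this
    exact h.ne v trivial this
  · by_cases ha : a ∈ F <;> by_cases hb : b ∈ F <;> simp only [ha, hb, if_true, if_false]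
    · exact fun h => hcon a b hab h ha hb
    · exact fun h => hb (hF a ha b hab h)
    · exact fun h => ha (hF b hb a hab.symm h.symm)
    · exact h.proper a trivial b trivial hab

theorem UniqueOn.exists_arc (h : UniqueOn G Set.univ c d) (v : V) : ∃ w, G.Adj v w ∧ c w = d v := by
  obtain ⟨x, y, hxy, -, hx, hy⟩ := h.exists_reach v
  rcases ReflTransGen.cases_head hx with rfl | ⟨w, hw, -⟩
  · rcases ReflTransGen.cases_head hy with rfl | ⟨w, hw, -⟩
    exacts [absurd rfl hxy.ne, ⟨w, hw.2⟩]
  · exact ⟨w, hw.2⟩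

/-- If recolouring any vertex forces both ends of an edge to receive the same colour, the colouring is
unique. -/
theorem uniqueOn_of_reach (hc : Proper G c) (h : ∀ v, ∃ x y, G.Adj x y ∧ d x = d y ∧
    ReflTransGen (ArcOn G c d Set.univ) v x ∧ ReflTransGen (ArcOn G c d Set.univ) v y) :
    UniqueOn G Set.univ c d := by
  have hne : ∀ v, d v ≠ c v := by
    intro v
    obtain ⟨x, y, hxy, -, hx, hy⟩ := h v
    have key : ∀ w, ArcOn G c d Set.univ v w → d v ≠ c v := fun w hw h =>
      hc v w hw.2.1 (h.symm.trans hw.2.2.symm)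
    rcases ReflTransGen.cases_head hx with rfl | ⟨w, hw, -⟩
    · rcases ReflTransGen.cases_head hy with rfl | ⟨w, hw, -⟩
      exacts [absurd rfl hxy.ne, key w hw]
    · exact key w hw
  refine ⟨hc.properOn _, fun v _ => hne v, fun g hg hgc v _ => ?_⟩
  by_contra hv
  have hprop : ∀ u, ReflTransGen (ArcOn G c d Set.univ) v u → g u = d u := by
    intro u hu
    induction hu with
    | refl => exact (hgc v trivial).resolve_left hv
    | @tail a b _ hab ih =>
      refine (hgc b trivial).resolve_left fun h => hg a trivial b trivial hab.2.1 ?_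
      rw [ih, h, hab.2.2]
  obtain ⟨x, y, hxy, hd, hx, hy⟩ := h v
  exact hg x trivial y trivial hxy (by rw [hprop x hx, hprop y hy, hd])

/-- Outside `S` second colours are chosen by `exists_flow`, so that every vertex leads into `S`. -/
theorem Core.good (h : Core G K) (hconn : ConnIn G Set.univ) : Good G K := by
  obtain ⟨c, hc, d, S, x, y, hx, hy, hxy, hd, hS⟩ := h
  obtain ⟨e, he⟩ := exists_flow G Sᶜ S
  let d' : V → K := fun z => if z ∈ S then d z else c (e z)
  have hdS : ∀ z ∈ S, d' z = d z := fun z hz => if_pos hz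
  have hdB : ∀ z ∈ basin G Sᶜ S, d' z = c (e z) := fun z hz => if_neg hz.1
  have harc : ∀ {a b}, ReflTransGen (ArcOn G c d S) a b →
      ReflTransGen (ArcOn G c d' Set.univ) a b := fun h =>
    ReflTransGen.mono (fun a b h => ⟨trivial, h.2.1, h.2.2.trans (hdS a h.1).symm⟩) _ _ h
  refine ⟨c, d', uniqueOn_of_reach hc fun v => ⟨x, y, hxy, by rw [hdS x hx, hdS y hy, hd], ?_⟩⟩
  by_cases hv : v ∈ S
  · exact ⟨harc (hS v hv).1, harc (hS v hv).2⟩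
  · have hvB : v ∈ basin G Sᶜ S := by
      obtain ⟨r, s, h1, -, h3, h4, -⟩ := (hconn v trivial x trivial).exists_first (Z := S) trivial
        hv hx
      exact ⟨hv, r, s, h1.mono fun z hz => hz.2, h4, h3⟩
    obtain ⟨z, hz, h⟩ := he c d' Set.univ hdB (Set.subset_univ _) v hvB
    exact ⟨h.trans (harc (hS z hz).1), h.trans (harc (hS z hz).2)⟩

/-- A vertex with the fewest reachable vertices is reachable from all of them. -/
theorem exists_sink [Finite V] [Nonempty V] (r : V → V → Prop) :
    ∃ v, ∀ u, ReflTransGen r v u → ReflTransGen r u v := by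
  obtain ⟨v, hv⟩ := Finite.exists_min fun v => {u | ReflTransGen r v u}.ncard
  refine ⟨v, fun u hu => ?_⟩
  have hsub : {w | ReflTransGen r u w} ⊆ {w | ReflTransGen r v w} := fun w hw => hu.trans hw
  have heq := Set.eq_of_subset_of_ncard_le hsub (hv u)
  have : v ∈ {w | ReflTransGen r v w} := ReflTransGen.refl
  rwa [← heq] at this

/-- A bad edge inside a strongly connected set of arcs. -/
theorem UniqueOn.exists_strong [Finite V] [Nonempty V] (h : UniqueOn G Set.univ c d) :
    ∃ x y, G.Adj x y ∧ d x = d y ∧ ∀ u, ReflTransGen (ArcOn G c d Set.univ) x u →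
      ReflTransGen (ArcOn G c d Set.univ) u x ∧ ReflTransGen (ArcOn G c d Set.univ) u y := by
  obtain ⟨v, hv⟩ := exists_sink (ArcOn G c d Set.univ)
  obtain ⟨x, y, hxy, hd, hx, hy⟩ := h.exists_reach v
  exact ⟨x, y, hxy, hd, fun u hu => ⟨(hv u (hx.trans hu)).trans hx, (hv u (hx.trans hu)).trans hy⟩⟩

/-- In a complete graph `c` is injective on the set `F` reachable from a strong bad edge `xy`. Every
vertex of `F` has an incoming arc from `F`, so `c '' F ⊆ d '' F`. By counting, `d` is injective on
`F`, against `d x = d y`. -/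
theorem Good.exists_not_adj [Finite V] [Nonempty V] (h : Good G K) :
    ∃ u v, u ≠ v ∧ ¬ G.Adj u v := by
  by_contra! hcon
  obtain ⟨c, d, h⟩ := h
  obtain ⟨x, y, hxy, hd, hstr⟩ := h.exists_strong
  let F : Set V := {u | ReflTransGen (ArcOn G c d Set.univ) x u}
  have hcF : c '' F ⊆ d '' F := by
    rintro _ ⟨u, hu, rfl⟩
    obtain ⟨w, hwu, hw⟩ : ∃ w, w ∈ F ∧ ArcOn G c d Set.univ w u := by
      by_cases hux : u = x
      · rcases ReflTransGen.cases_tail (hstr y (hstr x .refl).2).1 with h | ⟨w, h1, h2⟩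
        · exact absurd h hxy.ne
        · exact ⟨w, (hstr x .refl).2.trans h1, hux ▸ h2⟩
      · rcases ReflTransGen.cases_tail hu with h | ⟨w, h1, h2⟩
        · exact absurd h hux
        · exact ⟨w, h1, h2⟩
    exact ⟨w, hwu, hw.2.2.symm⟩
  have hinj : Set.InjOn c F := by
    intro u _ v _ huv
    by_contra hne
    exact h.proper u trivial v trivial (hcon u v hne) huv
  have hcard : (d '' F).ncard = F.ncard := by
    refine le_antisymm (Set.ncard_image_le (Set.toFinite F)) ?_
    rw [← hinj.ncard_image]
    exact Set.ncard_le_ncard hcF ((Set.toFinite F).image d)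
  have hdinj := Set.injOn_of_ncard_image_eq hcard (Set.toFinite F)
  exact hxy.ne (hdinj ReflTransGen.refl (hstr x .refl).2 hd)

/-- Arcs from the ends of a bad edge lead to vertices on opposite sides with the same colour. These
are not adjacent. -/
theorem Good.exists_not_adj_of_bipartite [Nonempty V] (h : Good G K) {f : V → Bool}
    (hf : Proper G f) : ∃ u v, f u ≠ f v ∧ ¬ G.Adj u v := by
  by_contra! hcon
  obtain ⟨c, d, h⟩ := h
  obtain ⟨x, y, hxy, hd, -⟩ := h.exists_reach (Classical.arbitrary V)
  obtain ⟨x', hx, hcx⟩ := h.exists_arc x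
  obtain ⟨y', hy, hcy⟩ := h.exists_arc y
  have h1 := hf _ _ hxy
  have h2 := hf _ _ hx
  have h3 := hf _ _ hy
  have h4 : f x' ≠ f y' := by
    revert h1 h2 h3
    cases f x <;> cases f y <;> cases f x' <;> cases f y' <;> simp
  exact h.proper x' trivial y' trivial (hcon x' y' h4) (by rw [hcx, hcy, hd])

/-- With all degrees at most two, follow the cycle from `x` away from a strong bad edge `xy`. Strong
connectedness forces arcs both ways along each new edge, so `(c, d)` alternates between `(c x, d x)`
and `(d x, c x)`. Neither pair fits `y`, so the path would grow forever. -/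
theorem Good.exists_three_nbrs [Finite V] [Nonempty V] (h : Good G K) :
    ∃ w z b b', G.Adj w z ∧ G.Adj w b ∧ G.Adj w b' ∧ b ≠ z ∧ b' ≠ z ∧ b ≠ b' := by
  by_contra! hcon
  obtain ⟨c, d, h⟩ := h
  obtain ⟨x, y, hxy, hd, hstr⟩ := h.exists_strong
  have hnarc : ∀ u v, (u = x ∧ v = y) ∨ (u = y ∧ v = x) → ¬ ArcOn G c d Set.univ u v := by
    rintro u v (⟨rfl, rfl⟩ | ⟨rfl, rfl⟩) harc
    · exact h.ne v trivial (hd.symm.trans harc.2.2.symm)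
    · exact h.ne v trivial (hd.trans harc.2.2.symm)
  have hdx : d x ≠ c x := h.ne x trivial
  -- An initial part `R` of the path from `x` to `y` around the cycle, with last vertex `p`.
  let Q : Set V → V → Prop := fun R p => x ∈ R ∧ y ∉ R ∧ p ∈ R ∧
    (∀ u ∈ R, ∀ v ∉ R, G.Adj u v → u = p ∨ (u = x ∧ v = y)) ∧
    (∃ o, G.Adj p o ∧ (o ∈ R ∨ (p = x ∧ o = y))) ∧
    ((c p = c x ∧ d p = d x) ∨ (c p = d x ∧ d p = c x))
  have hQ : ∀ n : ℕ, ∃ R p, Q R p ∧ R.ncard = n + 1 := by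
    intro n
    induction n with
    | zero =>
      refine ⟨{x}, x, ⟨rfl, hxy.ne', rfl, ?_, ⟨y, hxy, .inr ⟨rfl, rfl⟩⟩, .inl ⟨rfl, rfl⟩⟩, by simp⟩
      rintro u rfl v - -
      exact .inl rfl
    | succ n ih =>
      obtain ⟨R, p, ⟨hxR, hyR, hpR, hbd, ⟨o, hpo, ho⟩, hcol⟩, hcard⟩ := ih
      have hexit : ∀ {u v}, ReflTransGen (ArcOn G c d Set.univ) u v → u ∈ R → v ∉ R →
          ∃ a ∈ R, ∃ b ∉ R, ArcOn G c d Set.univ a b := by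
        intro u v huv hu hv
        induction huv with
        | refl => exact absurd hu hv
        | @tail a b _ hab ih =>
          by_cases ha : a ∈ R
          · exact ⟨a, ha, b, hv, hab⟩
          · exact ih ha
      have henter : ∀ {u v}, ReflTransGen (ArcOn G c d Set.univ) u v → u ∉ R → v ∈ R →
          ∃ a ∉ R, ∃ b ∈ R, ArcOn G c d Set.univ a b := by
        intro u v huv hu hv
        induction huv with
        | refl => exact absurd hv hu
        | @tail a b _ hab ih =>
          by_cases ha : a ∈ R
          · exact ih ha
          · exact ⟨a, ha, b, hv, hab⟩
      obtain ⟨a, ha, w, hw, haw⟩ := hexit (hstr x .refl).2 hxR hyR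
      obtain rfl : a = p := (hbd a ha w hw haw.2.1).resolve_right fun h => hnarc a w (.inl h) haw
      obtain ⟨w', hw', b, hb, hwb⟩ := henter (hstr y (hstr x .refl).2).1 hyR hxR
      obtain rfl : b = a := (hbd b hb w' hw' hwb.2.1.symm).resolve_right fun h =>
        hnarc w' b (.inr ⟨h.2, h.1⟩) hwb
      have hwo : w ≠ o := by
        rintro rfl
        rcases ho with h | h
        exacts [hw h, hnarc b w (.inl h) haw]
      have hwo' : w' ≠ o := by
        rintro rfl
        rcases ho with h | ⟨h, h'⟩
        exacts [hw' h, hnarc w' b (.inr ⟨h', h⟩) hwb]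
      obtain rfl : w = w' := hcon b o w w' hpo haw.2.1 hwb.2.1.symm hwo hwo'
      have hcw : c w = d b := haw.2.2
      have hdw : d w = c b := hwb.2.2.symm
      have hcol' : (c w = c x ∧ d w = d x) ∨ (c w = d x ∧ d w = c x) := by
        rcases hcol with ⟨h1, h2⟩ | ⟨h1, h2⟩
        · exact .inr ⟨hcw.trans h2, hdw.trans h1⟩
        · exact .inl ⟨hcw.trans h2, hdw.trans h1⟩
      refine ⟨insert w R, w, ⟨.inr hxR, ?_, .inl rfl, ?_, ⟨b, hwb.2.1, .inl (.inr hb)⟩, hcol'⟩, ?_⟩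
      · rintro (rfl | hy)
        · rcases hcol' with ⟨h1, -⟩ | ⟨-, h2⟩
          · exact h.proper x trivial y trivial hxy h1.symm
          · exact hdx (hd.trans h2)
        · exact hyR hy
      · rintro u (rfl | hu) v hv huv
        · exact .inl rfl
        · have hv1 : v ≠ w := fun h => hv (.inl h)
          have hv2 : v ∉ R := fun h => hv (.inr h)
          rcases hbd u hu v hv2 huv with rfl | h
          · by_cases hvo : v = o
            · rcases ho with h | ⟨h1, h2⟩
              · exact absurd (hvo ▸ h) hv2
              · exact .inr ⟨h1, hvo.trans h2⟩
            · exact absurd (hcon u o w v hpo haw.2.1 huv hwo hvo) hv1.symm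
          · exact .inr h
      · rw [Set.ncard_insert_of_notMem hw, hcard]
  obtain ⟨R, p, -, hR⟩ := hQ (Nat.card V)
  have := Set.ncard_le_card R
  omega

/-- A second colouring of one side must change the colour of `w`, or it would combine with `c` on
the other side. If both sides had one, both would give `w` the colour `d w` and could be combined.
-/
theorem UniqueOn.subset_or {w : V} {P : Set V} (hP : IsSide G w P) (h : UniqueOn G Set.univ c d) :
    UniqueOn G (insert w P) c d ∨ UniqueOn G Pᶜ c d := by
  by_contra! hcon
  obtain ⟨h1, h2⟩ := hcon
  have hex : ∀ U : Set V, ¬ UniqueOn G U c d → ∃ g : V → K, ProperOn G U g ∧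
      (∀ v ∈ U, g v = c v ∨ g v = d v) ∧ ∃ v ∈ U, g v ≠ c v := by
    intro U hU
    by_contra! hcon
    exact hU ⟨fun u _ v _ => h.proper u trivial v trivial, fun v _ => h.ne v trivial, hcon⟩
  have hglue : ∀ g₁ g₂ : V → K, ProperOn G (insert w P) g₁ → ProperOn G Pᶜ g₂ → g₁ w = g₂ w →
      (∀ v ∈ insert w P, g₁ v = c v ∨ g₁ v = d v) → (∀ v ∈ Pᶜ, g₂ v = c v ∨ g₂ v = d v) →
      (∀ v ∈ insert w P, g₁ v = c v) ∧ ∀ v ∈ Pᶜ, g₂ v = c v := by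
    intro g₁ g₂ hg₁ hg₂ hw hv₁ hv₂
    let g : V → K := fun z => if z ∈ P then g₁ z else g₂ z
    have hgP : ∀ z ∈ insert w P, g z = g₁ z := by
      rintro z (rfl | hz)
      · simp [g, hP.1, hw]
      · simp [g, hz]
    have hgP' : ∀ z ∈ Pᶜ, g z = g₂ z := fun z hz => if_neg hz
    have hcross : ∀ a b, G.Adj a b → a ∈ P → g a ≠ g b := by
      intro a b hab ha
      have hb : b ∈ insert w P := by
        by_cases hbw : b = w
        · exact .inl hbw
        · exact .inr (hP.2 a ha b hbw hab)
      rw [hgP a (.inr ha), hgP b hb]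
      exact hg₁ a (.inr ha) b hb hab
    have := h.unique g (fun a _ b _ hab => ?_) (fun v _ => ?_)
    · exact ⟨fun v hv => hgP v hv ▸ this v trivial, fun v hv => hgP' v hv ▸ this v trivial⟩
    · by_cases ha : a ∈ P
      · exact hcross a b hab ha
      by_cases hb : b ∈ P
      · exact (hcross b a hab.symm hb).symm
      rw [hgP' a ha, hgP' b hb]
      exact hg₂ a ha b hb hab
    · by_cases hv : v ∈ P
      · rw [hgP v (.inr hv)]
        exact hv₁ v (.inr hv)
      · rw [hgP' v hv]
        exact hv₂ v hv
  have hcp : ∀ U : Set V, ProperOn G U c := fun U u _ v _ => h.proper u trivial v trivial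
  have hwP : w ∈ Pᶜ := hP.1
  have hwP' : w ∈ insert w P := Set.mem_insert ..
  obtain ⟨g₁, hg₁, hv₁, u₁, hu₁, hne₁⟩ := hex _ h1
  obtain ⟨g₂, hg₂, hv₂, u₂, hu₂, hne₂⟩ := hex _ h2
  rcases hv₁ w hwP' with hw₁ | hw₁
  · exact hne₁ ((hglue g₁ c hg₁ (hcp _) hw₁ hv₁ fun _ _ => .inl rfl).1 u₁ hu₁)
  rcases hv₂ w hwP with hw₂ | hw₂
  · exact hne₂ ((hglue c g₂ (hcp _) hg₂ hw₂.symm (fun _ _ => .inl rfl) hv₂).2 u₂ hu₂)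
  · exact hne₁ ((hglue g₁ g₂ hg₁ hg₂ (hw₁.trans hw₂.symm) hv₁ hv₂).1 u₁ hu₁)

end Unique

/-! ### Reduction to two-connected graphs and to components -/

section Reduction

universe u

theorem Good.core_of_twoConn {V : Type u} [Finite V] [Nonempty V] {G : SimpleGraph V} {K : Type*}
    (hG : TwoConn G) {t : ℕ} (ht : 3 ≤ t) (h : Good G K) (hcol : ∃ c : V → Fin t, Proper G c) :
    Core G (Fin t) := by
  have hdeg := h.exists_three_nbrs
  by_cases hbip : ColOn G Set.univ 2
  · obtain ⟨f, h1, h2⟩ := hbip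
    have hf : Proper G fun v => decide (f v = 0) := by
      intro u v huv heq
      have hu := h1 u trivial
      have hv := h1 v trivial
      have hne := h2 u trivial v trivial huv
      have := decide_eq_decide.1 heq
      omega
    obtain ⟨w, z, b, b', hwz, hwb, hwb', hbz, -, -⟩ := id hdeg
    exact (core_of_bipartite hG (hG.connIn_univ hwz.ne hwb.ne hbz.symm) hf
      (h.exists_not_adj_of_bipartite hf) hdeg).map (Fin.castLE_injective ht)
  · refine denseCore ht V G Set.univ ⟨fun w x _ y _ hx hy => hG w x hx y hy, hbip, ?_, ?_⟩ hcol
    · obtain ⟨w, z, b, b', h⟩ := hdeg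
      exact ⟨w, trivial, z, trivial, b, trivial, b', trivial, h⟩
    · obtain ⟨u, v, h⟩ := h.exists_not_adj
      exact ⟨u, trivial, v, trivial, h⟩

/-- Induction on the number of vertices: at a cut vertex, `UniqueOn.subset_or` provides a smaller
uniquely colourable side, whose core extends by `Core.of_side`. -/
theorem Good.core {V : Type u} [Finite V] [Nonempty V] {G : SimpleGraph V} {K : Type*} {t : ℕ}
    (ht : 3 ≤ t) (h : Good G K) (hcol : ∃ c : V → Fin t, Proper G c) : Core G (Fin t) := by
  have main : ∀ n, ∀ (V : Type u) [Finite V] [Nonempty V] (G : SimpleGraph V), Nat.card V = n →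
      Good G K → (∃ c : V → Fin t, Proper G c) → Core G (Fin t) := by
    intro n
    induction n using Nat.strong_induction_on with
    | _ n ih =>
      intro V _ _ G hn h hcol
      by_cases hG : TwoConn G
      · exact h.core_of_twoConn hG ht hcol
      simp only [TwoConn, ConnIn, not_forall] at hG
      obtain ⟨w, x, hx, y, hy, hxy⟩ := hG
      obtain ⟨c, hc⟩ := hcol
      have hside : ∀ P : Set V, IsSide G w P → (∃ z, z ∉ insert w P) →
          Good (G.induce (insert w P)) K → Core G (Fin t) := by
        rintro P hP ⟨z, hz⟩ hgood
        have hlt : Nat.card (insert w P : Set V) < n := by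
          rw [← hn, Nat.card_coe_set_eq, ← Set.ncard_univ]
          exact Set.ncard_lt_ncard ⟨Set.subset_univ _, fun h => hz (h trivial)⟩
        have : Nonempty (insert w P : Set V) := ⟨⟨w, .inl rfl⟩⟩
        exact Core.of_side hP (ih _ hlt _ _ rfl hgood ⟨_, hc.induce _⟩) hc
      set P := compIn G {w}ᶜ x with hPdef
      have hP : IsSide G w P := isSide_compIn w x
      obtain ⟨c₀, d₀, h⟩ := h
      rcases h.subset_or hP with h1 | h2
      · refine hside P hP ⟨y, ?_⟩ h1.good_induce
        rintro (h | h)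
        exacts [hy h, hxy h.2]
      · have hQ : IsSide G w (insert w P)ᶜ := by
          refine ⟨fun h => h (.inl rfl), fun a ha b hb hab hb' => ha (.inr ?_)⟩
          exact hP.2 b (hb'.resolve_left hb) a (fun h => ha (.inl h)) hab.symm
        have heq : insert w (insert w P)ᶜ = Pᶜ := by
          ext z
          by_cases hz : z = w
          · simp [hz, hP.1]
          · simp [hz]
        refine hside _ hQ ⟨x, ?_⟩ ?_
        · rw [heq]
          exact fun h => h (mem_compIn_self hx)
        · rw [heq]
          exact h2.good_induce
  exact main _ V G rfl h hcol

variable {V : Type u} {G : SimpleGraph V}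

theorem compIn_univ_eq {x y : V} (h : ReachIn G Set.univ x y) :
    compIn G Set.univ x = compIn G Set.univ y := by
  ext z
  exact ⟨fun hz => ⟨trivial, h.symm.trans hz.2⟩, fun hz => ⟨trivial, h.trans hz.2⟩⟩

theorem UniqueOn.compIn {K : Type*} {c d : V → K} (h : UniqueOn G Set.univ c d) (x : V) :
    UniqueOn G (compIn G Set.univ x) c d := by
  set C := UniqueListColoring.compIn G Set.univ x with hC
  refine ⟨fun u _ v _ => h.proper u trivial v trivial, fun v _ => h.ne v trivial,
    fun g hg hgc v hv => ?_⟩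
  have hcl : ∀ a b, G.Adj a b → a ∈ C → b ∈ C := fun a b hab ha => compIn_closed ha hab trivial
  have := h.unique (fun z => if z ∈ C then g z else c z) (fun a _ b _ hab => ?_) (fun z _ => ?_) v
    trivial
  · simpa only [hv, if_true] using this
  · by_cases ha : a ∈ C
    · have hb := hcl a b hab ha
      simp only [ha, hb, if_true]
      exact hg a ha b hb hab
    · have hb : b ∉ C := fun hb => ha (hcl b a hab.symm hb)
      simp only [ha, hb, if_false]
      exact h.proper a trivial b trivial hab
  · by_cases hz : z ∈ C
    · simpa only [hz, if_true] using hgc z hz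
    · simp [hz]

/-- A core determines the colouring only in its own component, so each component is treated
separately. -/
theorem Good.fin {K : Type*} [Finite V] {t : ℕ} (ht : 3 ≤ t) (h : Good G K)
    (hcol : ∃ c : V → Fin t, Proper G c) : Good G (Fin t) := by
  obtain ⟨c₀, d₀, h⟩ := h
  obtain ⟨f, hf⟩ := hcol
  have : Nonempty (Fin t) := ⟨⟨0, by omega⟩⟩
  -- The choice is indexed by the component as a set, so that all its vertices use the same pair
  -- `c`, `d`.
  have hcomp : ∀ C : Set V, ∃ c d : V → Fin t, ∀ x, C = compIn G Set.univ x → UniqueOn G C c d := by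
    intro C
    by_cases hC : ∃ x, C = compIn G Set.univ x
    · obtain ⟨x, rfl⟩ := hC
      have : Nonempty (compIn G Set.univ x) := ⟨⟨x, mem_compIn_self trivial⟩⟩
      have hcore := (h.compIn x).good_induce.core ht ⟨_, hf.induce _⟩
      have hconn : ConnIn (G.induce (compIn G Set.univ x)) Set.univ := by
        rintro ⟨a, ha⟩ - ⟨b, hb⟩ -
        exact ((connIn_compIn (U := Set.univ) trivial a ha b hb).induce subset_rfl ha hb).mono
          (Set.subset_univ _)
      obtain ⟨c, d, hcd⟩ := (hcore.good hconn).uniqueOn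
      exact ⟨c, d, fun _ _ => hcd⟩
    · exact ⟨f, f, fun x hx => absurd ⟨x, hx⟩ hC⟩
  choose c d hcd using hcomp
  have hself : ∀ v : V, v ∈ compIn G Set.univ v := fun v => mem_compIn_self trivial
  have heq : ∀ u v, u ∈ compIn G Set.univ v → compIn G Set.univ u = compIn G Set.univ v :=
    fun u v h => (compIn_univ_eq h.2).symm
  refine ⟨fun v => c (compIn G Set.univ v) v, fun v => d (compIn G Set.univ v) v,
    fun u _ v _ huv => ?_, fun v _ => (hcd _ v rfl).ne v (hself v), fun g hg hgc v _ => ?_⟩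
  · have hu : u ∈ compIn G Set.univ v := compIn_closed (hself v) huv.symm trivial
    have := (hcd _ v rfl).proper u hu v (hself v) huv
    simpa only [heq u v hu] using this
  · refine (hcd _ v rfl).unique g (fun a _ b _ => hg a trivial b trivial) (fun a ha => ?_) v (hself v)
    simpa only [heq a v ha] using hgc a trivial

end Reduction

/-! ### List assignments -/

section Lists

variable {V : Type*} [Fintype V] {G : SimpleGraph V}

theorem UniquelyListColorableWith.good {s : ℕ}
    (h : UniquelyListColorableWith G (fun _ => 2) s) : Good G ℕ := by
  obtain ⟨L, ⟨hL, -⟩, c, hc, huniq⟩ := h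
  have hd : ∀ v, ∃ d, d ≠ c v ∧ d ∈ L v := fun v => by
    obtain ⟨d, h1, h2⟩ := Finset.exists_mem_ne (s := L v) (by rw [hL v]; norm_num) (c v)
    exact ⟨d, h2, h1⟩
  choose d hd1 hd2 using hd
  refine ⟨c, d, fun u _ v _ huv => c.valid huv, fun v _ => hd1 v, fun g hg hgc v _ => ?_⟩
  have := huniq (SimpleGraph.Coloring.mk g fun {u v} huv => hg u trivial v trivial huv) fun v => ?_
  · exact congrArg (fun f : G.Coloring ℕ => f v) this
  · rcases hgc v trivial with h | h
    · exact (show g v ∈ L v from h ▸ hc v)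
    · exact (show g v ∈ L v from h ▸ hd2 v)

theorem Good.exists_list {t : ℕ} (h : Good G (Fin t)) :
    ∃ s ≤ t, UniquelyListColorableWith G (fun _ => 2) s := by
  obtain ⟨c, d, h⟩ := h
  let L : V → Finset ℕ := fun v => {(c v : ℕ), (d v : ℕ)}
  refine ⟨(Finset.univ.biUnion L).card, ?_, L, ⟨fun v => ?_, rfl⟩,
    SimpleGraph.Coloring.mk (fun v => (c v : ℕ)) fun {u v} huv heq =>
      h.proper u trivial v trivial huv (Fin.ext heq), fun v => ?_, fun g hg => ?_⟩
  · have hsub : Finset.univ.biUnion L ⊆ Finset.range t := by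
      intro i hi
      simp only [L, Finset.mem_biUnion, Finset.mem_insert, Finset.mem_singleton] at hi
      obtain ⟨v, -, rfl | rfl⟩ := hi <;> simp
    simpa using Finset.card_le_card hsub
  · exact Finset.card_pair fun heq => h.ne v trivial (Fin.ext heq.symm)
  · exact (show (c v : ℕ) ∈ L v by simp [L])
  · have hg' : ∀ v, g v = c v ∨ g v = d v := fun v => by
      simpa [L] using hg v
    have hlt : ∀ v, g v < t := fun v => by
      rcases hg' v with h | h <;> rw [h] <;> exact Fin.is_lt _
    have := h.unique (fun v => ⟨g v, hlt v⟩)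
      (fun u _ v _ huv heq => g.valid huv (congrArg Fin.val heq))
      fun v _ => (hg' v).imp (fun h => Fin.ext h) fun h => Fin.ext h
    ext v
    exact congrArg Fin.val (this v trivial)

theorem UniquelyListColorableWith.colorable {f : V → ℕ} {s : ℕ}
    (h : UniquelyListColorableWith G f s) : G.Colorable s := by
  obtain ⟨L, ⟨-, hs⟩, c, hc, -⟩ := h
  have hmem : ∀ v, c v ∈ Finset.univ.biUnion L := fun v =>
    Finset.mem_biUnion.2 ⟨v, Finset.mem_univ v, hc v⟩
  have := (SimpleGraph.Coloring.mk (G := G)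
    (fun v => (⟨c v, hmem v⟩ : {i // i ∈ Finset.univ.biUnion L}))
    fun {u v} huv heq => c.valid huv (congrArg Subtype.val heq)).colorable
  rwa [Fintype.card_coe, hs] at this

/-- With at most two colours all lists coincide, and exchanging the two colours gives a second
colouring. -/
theorem UniquelyListColorableWith.three_le [Nonempty V] {s : ℕ}
    (h : UniquelyListColorableWith G (fun _ => 2) s) : 3 ≤ s := by
  obtain ⟨L, ⟨hL, hs⟩, c, hc, huniq⟩ := h
  by_contra! hlt
  have hall : ∀ v, L v = Finset.univ.biUnion L := fun v =>
    Finset.eq_of_subset_of_card_le (Finset.subset_biUnion_of_mem L (Finset.mem_univ v))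
      (by rw [hs, hL v]; exact Nat.le_of_lt_succ hlt)
  have hsame : ∀ u v, L u = L v := fun u v => (hall u).trans (hall v).symm
  let v₀ : V := Classical.arbitrary V
  obtain ⟨b, hb, hbc⟩ := Finset.exists_mem_ne (s := L v₀) (by rw [hL v₀]; norm_num) (c v₀)
  have := huniq (SimpleGraph.Coloring.mk (fun v => Equiv.swap (c v₀) b (c v))
    fun {u v} huv heq => c.valid huv (Equiv.injective _ heq)) fun v => ?_
  · have h0 := congrArg (fun f : G.Coloring ℕ => f v₀) this
    have h1 : Equiv.swap (c v₀) b (c v₀) = c v₀ := h0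
    rw [Equiv.swap_apply_left] at h1
    exact hbc h1
  · change Equiv.swap (c v₀) b (c v) ∈ L v
    rw [Equiv.swap_apply_def]
    split_ifs
    · exact hsame v₀ v ▸ hb
    · exact hsame v₀ v ▸ hc v₀
    · exact hc v

end Lists

end UniqueListColoring

theorem theorem5 {V : Type*} [Fintype V] [Nonempty V] (G : SimpleGraph V) (t : ℕ)
    (ht : (t : ℕ∞) = max 3 G.chromaticNumber) :
    (UniqueListColoring.UniquelyListColorable G (fun _ => 2) ↔
      UniqueListColoring.UniquelyListColorableWith G (fun _ => 2) t) ∧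
    (UniqueListColoring.UniquelyListColorable G (fun _ => 2) →
      UniqueListColoring.uniqueListChromaticNumber G 2 = t) := by
  have ht3 : 3 ≤ t := by
    have : ((3 : ℕ) : ℕ∞) ≤ t := ht ▸ le_max_left _ _
    exact_mod_cast this
  have hcol : G.Colorable t :=
    SimpleGraph.chromaticNumber_le_iff_colorable.1 (ht ▸ le_max_right _ _)
  have hlower : ∀ s, UniqueListColoring.UniquelyListColorableWith G (fun _ => 2) s → t ≤ s := by
    intro s hs
    have : (t : ℕ∞) ≤ s := ht ▸ max_le (by exact_mod_cast hs.three_le)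
      (SimpleGraph.chromaticNumber_le_iff_colorable.2 hs.colorable)
    exact_mod_cast this
  have hupper : UniqueListColoring.UniquelyListColorable G (fun _ => 2) →
      UniqueListColoring.UniquelyListColorableWith G (fun _ => 2) t := by
    rintro ⟨s, hs⟩
    obtain ⟨f⟩ := hcol
    obtain ⟨r, hr, h⟩ := (hs.good.fin ht3 ⟨f, fun u v huv => f.valid huv⟩).exists_list
    -- The lists obtained use at most `t` colours; the lower bound shows that they use exactly `t`.
    rwa [le_antisymm hr (hlower r h)] at h
  refine ⟨⟨hupper, fun h => ⟨t, h⟩⟩, fun h => le_antisymm (Nat.sInf_le (hupper h)) ?_⟩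
  exact hlower _ (Nat.sInf_mem (s := {t | UniqueListColoring.UniquelyListColorableWith G _ t})
    ⟨t, hupper h⟩)
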